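/- Conventions. A weight is an almost everywhere positive, locally integrable function on $\mathbb R^n$; $w(E)=\int_E w\,dx$, and $B$ denotes an open ball. For $1<p<\infty$, a weight $w$ belongs to $A_p$ if $$\sup_{B}\Big(\frac1{|B|}\int_B w\,dx\Big)\Big(\frac1{|B|}\int_B w^{\frac1{1-p}}\,dx\Big)^{p-1}<\infty ,$$ it belongs to $A_1$ if $Mw\le Cw$ almost everywhere for some constant $C$, and $A_\infty=\bigcup_{1\le p<\infty}A_p$. Here $$Mf(x)=\sup_{\tau>0}\frac1{|B(x,\tau)|}\int_{B(x,\tau)}|f(y)|\,dy$$ is the centered Hardy–Littlewood maximal function. For weights $w,v$, $0<t<\infty$, $1<p<\infty$ and $1\le q\le\infty$, the weighted amalgam space $(L^p_w,L^q_v)_t(\mathbb R^n)$ consists of all measurable $f$ on $\mathbb R^n$ with $$\|f\|_{(L^p_w,L^q_v)_t}=\Big\|\Big(\frac1{w(B(\cdot,t))}\int_{B(\cdot,t)}|f(y)|^pw(y)\,dy\Big)^{1/p}\Big\|_{L^q_v(\mathbb R^n)}<\infty ,$$ where $L^q_v$ is $L^q(v\,dx)$ for $q<\infty$ and $L^\infty_v=L^\infty$.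 The weak space $W(L^p_w,L^q_v)_t(\mathbb R^n)$ consists of all measurable $f$ with $$\|f\|_{W(L^p_w,L^q_v)_t}=\sup_{\lambda>0}\lambda\,\big\|\chi_{\{|f|>\lambda\}}\big\|_{(L^p_w,L^q_v)_t}<\infty .$$ **Theorem.** Let $1<p<\infty$ and $w\in A_p$. (a) If $1<q\le\infty$ and $v\in A_q$, then there is a constant $C$, independent of $f$ and $t$, such that for all $0<t<\infty$ and all $f\in(L^p_w,L^q_v)_t(\mathbb R^n)$ the function $Mf$ belongs to $(L^p_w,L^q_v)_t(\mathbb R^n)$ and $$\|Mf\|_{(L^p_w,L^q_v)_t}\le C\,\|f\|_{(L^p_w,L^q_v)_t}.$$ (b) If $v\in A_1$, then there is a constant $C$, independent of $f$ and $t$, such that for all $0<t<\infty$ and all $f\in(L^p_w,L^1_v)_t(\mathbb R^n)$ the function $Mf$ belongs to $W(L^p_w,L^1_v)_t(\mathbb R^n)$ and $$\|Mf\|_{W(L^p_w,L^1_v)_t}\le C\,\|f\|_{(L^p_w,L^1_v)_t}.$$ -/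

import Mathlib

open MeasureTheory Metric
open scoped ENNReal NNReal

noncomputable section

namespace Amalgam

/-- The Euclidean space `ℝⁿ`. -/
abbrev Rn (n : ℕ) : Type := EuclideanSpace ℝ (Fin n)

variable {n : ℕ}

/-- A weight: a locally integrable function on `ℝⁿ` that is positive almost everywhere. -/
def IsWeight (w : Rn n → ℝ) : Prop :=
  LocallyIntegrable w volume ∧ ∀ᵐ x, 0 < w x

/-- The measure `w(x) dx`; in particular `w(B) = wMeasure w B`. -/
def wMeasure (w : Rn n → ℝ) : Measure (Rn n) :=
  volume.withDensity (fun x => ENNReal.ofReal (w x))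

/-- The centered Hardy–Littlewood maximal function,
`M f (x) = sup_{r > 0} |B(x,r)|⁻¹ ∫_{B(x,r)} |f|`, with values in `[0, ∞]`. -/
def maximal {F : Type*} [ENorm F] (f : Rn n → F) (x : Rn n) : ℝ≥0∞ :=
  ⨆ (r : ℝ) (_ : 0 < r), ⨍⁻ y in ball x r, ‖f y‖ₑ ∂volume

/-- The class `A_p` for `1 < p < ∞`. -/
def IsAp (p : ℝ) (w : Rn n → ℝ) : Prop :=
  IsWeight w ∧
    (⨆ (c : Rn n) (r : ℝ) (_ : 0 < r),
      (⨍⁻ x in ball c r, ENNReal.ofReal (w x) ∂volume) *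
        (⨍⁻ x in ball c r, ENNReal.ofReal (w x) ^ (1 / (1 - p)) ∂volume) ^ (p - 1)) < ∞

/-- The class `A_1`: `M w ≤ C w` almost everywhere. -/
def IsAOne (w : Rn n → ℝ) : Prop :=
  IsWeight w ∧ ∃ C : ℝ≥0, ∀ᵐ x, maximal w x ≤ C * ENNReal.ofReal (w x)

/-- The class `A_∞`: the union of the classes `A_p`, `1 ≤ p < ∞`. -/
def IsAInfty (w : Rn n → ℝ) : Prop :=
  IsAOne w ∨ ∃ p : ℝ, 1 < p ∧ IsAp p w

/-- The Muckenhoupt class `A_q` for an extended exponent `1 ≤ q ≤ ∞`. -/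
def IsMuckenhoupt (q : ℝ≥0∞) (w : Rn n → ℝ) : Prop :=
  (q = 1 ∧ IsAOne w) ∨ (1 < q ∧ q < ∞ ∧ IsAp q.toReal w) ∨ (q = ∞ ∧ IsAInfty w)

/-- The norm of `(L^p_w, L^q_v)_t`: the `L^q(v dx)` norm of
`x ↦ (w(B(x,t))⁻¹ ∫_{B(x,t)} |f|^p w dy)^{1/p}`. For `q = ∞` this is the essential supremum; as
`v > 0` almost everywhere, `v dx` and Lebesgue measure have the same null sets. -/
def amalgamNorm {F : Type*} [ENorm F] (t p : ℝ) (q : ℝ≥0∞) (w v : Rn n → ℝ) (f : Rn n → F) :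
    ℝ≥0∞ :=
  eLpNorm (fun x => (⨍⁻ y in ball x t, ‖f y‖ₑ ^ p ∂(wMeasure w)) ^ (1 / p)) q (wMeasure v)

/-- The norm of the weak space `W(L^p_w, L^q_v)_t`:
`sup_{a > 0} a ‖χ_{|f| > a}‖_{(L^p_w, L^q_v)_t}`. -/
def weakAmalgamNorm {F : Type*} [ENorm F] (t p : ℝ) (q : ℝ≥0∞) (w v : Rn n → ℝ)
    (f : Rn n → F) : ℝ≥0∞ :=
  ⨆ (a : ℝ≥0) (_ : 0 < a),
    (a : ℝ≥0∞) *
      amalgamNorm t p q w v ({x : Rn n | (a : ℝ≥0∞) < ‖f x‖ₑ}.indicator fun _ => (1 : ℝ≥0∞))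

/-- Membership in `(L^p_w, L^q_v)_t`. -/
def MemAmalgam {F : Type*} [TopologicalSpace F] [ENorm F] (t p : ℝ) (q : ℝ≥0∞)
    (w v : Rn n → ℝ) (f : Rn n → F) : Prop :=
  AEStronglyMeasurable f volume ∧ amalgamNorm t p q w v f < ∞

/-- Membership in the weak space `W(L^p_w, L^q_v)_t`. -/
def MemWeakAmalgam {F : Type*} [TopologicalSpace F] [ENorm F] (t p : ℝ) (q : ℝ≥0∞)
    (w v : Rn n → ℝ) (f : Rn n → F) : Prop :=
  AEStronglyMeasurable f volume ∧ weakAmalgamNorm t p q w v f < ∞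

end Amalgam

end

open Set

/-! Fix the scale t and let F(x) be the L^p(w) mean of f over B(x,t). The amalgam norm of f is the
L^q(v) norm of F, so part (a) reduces to a pointwise bound with constant independent of t: the local
mean of Mf is at most a constant times the Lebesgue maximal function of F
(`IsDualPair.localMean_maximal_le`). Muckenhoupt's theorem for v then finishes the case q < ∞, and
the trivial L^∞ bound the case q = ∞.

For y in B(x,t), averages of |f| over balls of radius at most t see only the part of f in B(x,2t).
Averages over larger balls are, by Tonelli, controlled by averages of averages at scale t, and these
by F because w is in A_p (`maximal_le_add`). The near part is estimated in L^p(w) by Muckenhoupt's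
theorem for w, and the integral of |f|^p over B(x,2t) by a Lebesgue average of F over B(x,3t)
(`setLIntegral_ball_le_mul_laverage_localMean`).

In part (b) this last average is kept as it stands: it is bounded on L^1(v), by Tonelli and Mv ≤ Kv.
Only the far part needs the maximal function of F, for which a weak (1,1) bound suffices
(`IsDualPair.mul_localMean_indicator_le`). Muckenhoupt's theorem itself follows from Lerner's
pointwise estimate and the maximal theorem for doubling measures. -/

namespace Amalgam

variable {n : ℕ}

/-! ### Weak type (1,1) for doubling measures. -/

section Doubling

variable {X : Type*} [PseudoMetricSpace X] [MeasurableSpace X]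

/-- The uncentered maximal function of `f` with respect to a measure `μ`. -/
noncomputable def umax (μ : Measure X) (f : X → ℝ≥0∞) (x : X) : ℝ≥0∞ :=
  ⨆ (c : X) (r : ℝ) (_ : x ∈ ball c r), ⨍⁻ y in ball c r, f y ∂μ

/-- Measures for which balls have positive finite measure and a ball of six times the radius
has comparable measure. -/
structure IsDoubling (μ : Measure X) (D : ℝ≥0) : Prop where
  pos : ∀ (c : X) (r : ℝ), 0 < r → μ (ball c r) ≠ 0
  fin : ∀ (c : X) (r : ℝ), μ (ball c r) ≠ ∞
  le : ∀ (c : X) (r : ℝ), 0 < r → μ (ball c (6 * r)) ≤ D * μ (ball c r)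

theorem laverage_le_umax (μ : Measure X) (f : X → ℝ≥0∞) {x c : X} {r : ℝ} (hx : x ∈ ball c r) :
    ⨍⁻ y in ball c r, f y ∂μ ≤ umax μ f x :=
  le_iSup_of_le c (le_iSup_of_le r (le_iSup_of_le hx le_rfl))

theorem umax_le {μ : Measure X} {f : X → ℝ≥0∞} {x : X} {a : ℝ≥0∞}
    (h : ∀ c r, x ∈ ball c r → ⨍⁻ y in ball c r, f y ∂μ ≤ a) : umax μ f x ≤ a :=
  iSup_le fun c => iSup_le fun r => iSup_le fun hx => h c r hx

theorem lt_umax_iff {μ : Measure X} {f : X → ℝ≥0∞} {x : X} {a : ℝ≥0∞} :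
    a < umax μ f x ↔ ∃ c r, x ∈ ball c r ∧ a < ⨍⁻ y in ball c r, f y ∂μ := by
  simp only [umax, lt_iSup_iff, exists_prop]

/-- A ball with a large average serves every point it contains. This makes `umax μ f` measurable for
an arbitrary `f`. -/
theorem isOpen_lt_umax (μ : Measure X) (f : X → ℝ≥0∞) (a : ℝ≥0∞) :
    IsOpen {x | a < umax μ f x} := by
  rw [isOpen_iff_forall_mem_open]
  rintro x hx
  obtain ⟨c, r, hxc, h⟩ := lt_umax_iff.1 hx
  exact ⟨ball c r, fun y hy => lt_umax_iff.2 ⟨c, r, hy, h⟩, isOpen_ball, hxc⟩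

theorem measurable_umax [OpensMeasurableSpace X] (μ : Measure X) (f : X → ℝ≥0∞) :
    Measurable (umax μ f) :=
  measurable_of_Ioi fun a => (isOpen_lt_umax μ f a).measurableSet

variable {μ : Measure X} {D : ℝ≥0}

theorem IsDoubling.mul_laverage (hμ : IsDoubling μ D) (f : X → ℝ≥0∞) (c : X) {r : ℝ}
    (hr : 0 < r) : μ (ball c r) * ⨍⁻ y in ball c r, f y ∂μ = ∫⁻ y in ball c r, f y ∂μ := by
  rw [setLAverage_eq, ENNReal.mul_div_cancel (hμ.pos c r hr) (hμ.fin c r)]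

theorem umax_le_add (hμ : IsDoubling μ D) {f g : X → ℝ≥0∞} {b : ℝ≥0∞}
    (h : ∀ x, f x ≤ g x + b) (x : X) : umax μ f x ≤ umax μ g x + b := by
  refine umax_le fun c r hx => ?_
  have hr : 0 < r := pos_of_mem_ball hx
  refine le_trans ?_ (add_le_add_left (laverage_le_umax μ g hx) b)
  rw [setLAverage_eq, setLAverage_eq]
  calc _ ≤ (∫⁻ y in ball c r, (g y + b) ∂μ) / μ (ball c r) := by
        gcongr with y; exact h y
    _ = _ := by
        rw [lintegral_add_right _ measurable_const, ENNReal.add_div, setLIntegral_const,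
          ENNReal.mul_div_cancel_right (hμ.pos c r hr) (hμ.fin c r)]

/-- The Vitali covering argument. -/
theorem IsDoubling.measure_biUnion_ball_le [SecondCountableTopology X] [OpensMeasurableSpace X]
    (hμ : IsDoubling μ D) (f : X → ℝ≥0∞) (a : ℝ≥0∞) (T : Set (X × ℝ)) {R : ℝ}
    (hT : ∀ b ∈ T, 0 < b.2 ∧ b.2 ≤ R ∧ a * μ (ball b.1 b.2) ≤ ∫⁻ y in ball b.1 b.2, f y ∂μ) :
    a * μ (⋃ b ∈ T, ball b.1 b.2) ≤ D * ∫⁻ x, f x ∂μ := by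
  obtain ⟨u, huT, hdisj, hcov⟩ := Vitali.exists_disjoint_subfamily_covering_enlargement_closedBall
    T (fun b => b.1) (fun b => b.2) R (fun b hb => (hT b hb).2.1) 5 (by norm_num)
  have hdisj' : u.PairwiseDisjoint fun b => ball b.1 b.2 :=
    hdisj.mono fun b => ball_subset_closedBall
  have hcount : u.Countable := hdisj'.countable_of_isOpen (fun b _ => isOpen_ball)
    fun b hb => nonempty_ball.2 (hT b (huT hb)).1
  have hsub : (⋃ b ∈ T, ball b.1 b.2) ⊆ ⋃ b ∈ u, ball b.1 (6 * b.2) := by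
    refine iUnion₂_subset fun b hb => ?_
    obtain ⟨b', hb', h⟩ := hcov b hb
    refine (ball_subset_closedBall.trans h).trans (subset_trans ?_ (subset_biUnion_of_mem hb'))
    -- Vitali gives closed balls of radius 5r; passing to open balls is why `IsDoubling` uses the
    -- factor 6.
    exact closedBall_subset_ball (by linarith [(hT b' (huT hb')).1])
  have := hcount.to_subtype
  calc a * μ (⋃ b ∈ T, ball b.1 b.2)
      ≤ a * ∑' b : u, μ (ball b.1.1 (6 * b.1.2)) := by
        gcongr
        exact (measure_mono hsub).trans (measure_biUnion_le μ hcount _)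
    _ ≤ a * ∑' b : u, D * μ (ball b.1.1 b.1.2) := by
        gcongr with b
        exact hμ.le _ _ (hT b.1 (huT b.2)).1
    _ = D * ∑' b : u, a * μ (ball b.1.1 b.1.2) := by
        rw [ENNReal.tsum_mul_left, ENNReal.tsum_mul_left]; ring
    _ ≤ D * ∑' b : u, ∫⁻ y in ball b.1.1 b.1.2, f y ∂μ := by
        gcongr with b
        exact (hT b.1 (huT b.2)).2.2
    _ = D * ∫⁻ y in ⋃ b ∈ u, ball b.1 b.2, f y ∂μ := by
        rw [lintegral_biUnion hcount (fun b _ => measurableSet_ball) hdisj']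
    _ ≤ _ := mul_le_mul_right (setLIntegral_le_lintegral _ _) _

/-- The weak type `(1,1)` inequality. -/
theorem IsDoubling.mul_measure_lt_umax_le [SecondCountableTopology X] [OpensMeasurableSpace X]
    (hμ : IsDoubling μ D) (f : X → ℝ≥0∞) (a : ℝ≥0∞) :
    a * μ {x | a < umax μ f x} ≤ D * ∫⁻ x, f x ∂μ := by
  -- The covering argument needs bounded radii, so the radius is capped at `k` and `k` tends to
  -- infinity.
  let T : ℕ → Set (X × ℝ) := fun k =>
    {b | 0 < b.2 ∧ b.2 ≤ k ∧ a * μ (ball b.1 b.2) ≤ ∫⁻ y in ball b.1 b.2, f y ∂μ}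
  have hmono : Monotone fun k => ⋃ b ∈ T k, ball b.1 b.2 := by
    intro k l hkl
    refine biUnion_subset_biUnion_left fun b hb => ⟨hb.1, hb.2.1.trans ?_, hb.2.2⟩
    exact_mod_cast hkl
  have hsub : {x | a < umax μ f x} ⊆ ⋃ k, ⋃ b ∈ T k, ball b.1 b.2 := by
    intro x hx
    obtain ⟨c, r, hxc, h⟩ := lt_umax_iff.1 hx
    have hr := pos_of_mem_ball hxc
    obtain ⟨k, hk⟩ := exists_nat_ge r
    refine mem_iUnion.2 ⟨k, mem_iUnion₂.2 ⟨(c, r), ⟨hr, hk, ?_⟩, hxc⟩⟩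
    rw [← hμ.mul_laverage f c hr, mul_comm]
    gcongr
  calc _ ≤ a * μ (⋃ k, ⋃ b ∈ T k, ball b.1 b.2) := by gcongr
    _ = ⨆ k, a * μ (⋃ b ∈ T k, ball b.1 b.2) := by
        rw [hmono.measure_iUnion, ENNReal.mul_iSup]
    _ ≤ _ := iSup_le fun k => hμ.measure_biUnion_ball_le f a (T k) fun b hb => hb

end Doubling

/-! ### Layer-cake formula and strong type bounds for doubling measures. -/

theorem lintegral_rpow_indicator_of_ne_top {s : ℝ} (hs : 0 < s) {a : ℝ≥0∞} (ha : a ≠ ∞) :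
    ∫⁻ l in Ioi (0 : ℝ), {l : ℝ | ENNReal.ofReal l < a}.indicator
      (fun l => ENNReal.ofReal (s * l ^ (s - 1))) l = a ^ s := by
  have hset : MeasurableSet {l : ℝ | ENNReal.ofReal l < a} :=
    measurableSet_lt ENNReal.measurable_ofReal measurable_const
  rw [lintegral_indicator hset, Measure.restrict_restrict hset]
  have h1 : {l : ℝ | ENNReal.ofReal l < a} ∩ Ioi 0 = Ioo 0 a.toReal := by
    ext l
    simp only [mem_inter_iff, mem_ofPred_eq, mem_Ioi, mem_Ioo]
    constructor
    · rintro ⟨h, h0⟩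
      exact ⟨h0, (ENNReal.ofReal_lt_iff_lt_toReal h0.le ha).1 h⟩
    · rintro ⟨h0, h⟩
      exact ⟨(ENNReal.ofReal_lt_iff_lt_toReal h0.le ha).2 h, h0⟩
  have hint : IntervalIntegrable (fun l : ℝ => s * l ^ (s - 1)) volume 0 a.toReal :=
    (intervalIntegral.intervalIntegrable_rpow' (by linarith)).const_mul s
  rw [h1, ← ofReal_integral_eq_lintegral_ofReal]
  · rw [← integral_Ioc_eq_integral_Ioo, ← intervalIntegral.integral_of_le ENNReal.toReal_nonneg,
      intervalIntegral.integral_const_mul, integral_rpow (Or.inl (by linarith))]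
    have : s * ((a.toReal ^ (s - 1 + 1) - 0 ^ (s - 1 + 1)) / (s - 1 + 1)) = a.toReal ^ s := by
      rw [sub_add_cancel, Real.zero_rpow hs.ne']; field_simp; ring
    rw [this, ← ENNReal.ofReal_rpow_of_nonneg ENNReal.toReal_nonneg hs.le, ENNReal.ofReal_toReal ha]
  · exact ((intervalIntegrable_iff_integrableOn_Ioc_of_le ENNReal.toReal_nonneg).1 hint).mono_set
      Ioo_subset_Ioc_self
  · refine (ae_restrict_iff' measurableSet_Ioo).2 (Filter.Eventually.of_forall fun l hl => ?_)
    have := hl.1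
    show 0 ≤ s * l ^ (s - 1)
    positivity

theorem lintegral_rpow_indicator {s : ℝ} (hs : 0 < s) (a : ℝ≥0∞) :
    ∫⁻ l in Ioi (0 : ℝ), {l : ℝ | ENNReal.ofReal l < a}.indicator
      (fun l => ENNReal.ofReal (s * l ^ (s - 1))) l = a ^ s := by
  rcases eq_or_ne a ∞ with rfl | ha
  · rw [ENNReal.top_rpow_of_pos hs]
    refine ENNReal.eq_top_of_forall_nnreal_le fun b => ?_
    -- The finite case at level `b ^ (1 / s)` has value `b` and bounds the integral from below.
    have hb : ((b : ℝ≥0∞) ^ (1 / s)) ≠ ∞ :=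
      ENNReal.rpow_ne_top_of_nonneg (by positivity) ENNReal.coe_ne_top
    have := lintegral_rpow_indicator_of_ne_top hs hb
    rw [← ENNReal.rpow_mul, one_div_mul_cancel hs.ne', ENNReal.rpow_one] at this
    rw [← this]
    gcongr with l
    exact le_top
  · exact lintegral_rpow_indicator_of_ne_top hs ha

section Strong

variable {X : Type*} [PseudoMetricSpace X] [MeasurableSpace X] [SecondCountableTopology X]
  [OpensMeasurableSpace X] {μ : Measure X} {D : ℝ≥0}

/-- The values of `f` not exceeding a/2 raise the maximal function by at most a/2, so the weak type
bound at level a/2 is needed only for the large values. This truncation makes the Marcinkiewicz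
interpolation integral converge. -/
theorem IsDoubling.mul_measure_lt_umax_le_setLIntegral (hμ : IsDoubling μ D) {f : X → ℝ≥0∞}
    (hf : Measurable f) (a : ℝ≥0∞) :
    a * μ {x | a < umax μ f x} ≤ 2 * D * ∫⁻ x, {x | a < 2 * f x}.indicator f x ∂μ := by
  rcases eq_or_ne a ∞ with rfl | ha
  · simp
  set g := {x | a < 2 * f x}.indicator f
  have hset : MeasurableSet {x | a < 2 * f x} := measurableSet_lt measurable_const (hf.const_mul 2)
  have hfg : ∀ x, f x ≤ g x + a / 2 := by
    intro x
    by_cases hx : a < 2 * f x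
    · simp [g, hx]
    · simp only [g, mem_ofPred_eq, hx, not_false_eq_true, indicator_of_notMem, zero_add]
      rw [ENNReal.le_div_iff_mul_le (by simp) (by simp), mul_comm]
      exact not_lt.1 hx
  have hsub : {x | a < umax μ f x} ⊆ {x | a / 2 < umax μ g x} := by
    intro x hx
    by_contra h
    have h1 := umax_le_add hμ hfg x
    have h2 : umax μ f x ≤ a := h1.trans ((add_le_add_left (not_lt.1 h) _).trans
      (ENNReal.add_halves a).le)
    exact absurd hx (not_lt.2 h2)
  calc a * μ {x | a < umax μ f x} ≤ a * μ {x | a / 2 < umax μ g x} := by gcongr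
    _ = 2 * (a / 2 * μ {x | a / 2 < umax μ g x}) := by
        rw [← mul_assoc, ENNReal.mul_div_cancel (by simp) (by simp)]
    _ ≤ 2 * (D * ∫⁻ x, g x ∂μ) := mul_le_mul_right (hμ.mul_measure_lt_umax_le g _) _
    _ = _ := by ring

/-- The maximal theorem for doubling measures. -/
theorem IsDoubling.lintegral_umax_rpow_le [SFinite μ] (hμ : IsDoubling μ D) {p : ℝ} (hp : 1 < p) :
    ∃ C : ℝ≥0, ∀ f : X → ℝ≥0∞, Measurable f →
      ∫⁻ x, umax μ f x ^ p ∂μ ≤ C * ∫⁻ x, f x ^ p ∂μ := by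
  have hp0 : 0 < p := by linarith
  have hp1 : 0 < p - 1 := by linarith
  refine ⟨2 * D * (p / (p - 1)).toNNReal * 2 ^ (p - 1), fun f hf => ?_⟩
  have hM := measurable_umax μ f
  have swap : ∀ (s : ℝ) (h k : X → ℝ≥0∞), Measurable h → Measurable k →
      ∫⁻ x, k x * (∫⁻ l in Ioi (0 : ℝ), {l : ℝ | ENNReal.ofReal l < h x}.indicator
        (fun l => ENNReal.ofReal (s * l ^ (s - 1))) l) ∂μ =
      ∫⁻ l in Ioi (0 : ℝ), ENNReal.ofReal (s * l ^ (s - 1)) *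
        ∫⁻ x, {x | ENNReal.ofReal l < h x}.indicator k x ∂μ := by
    intro s h k hh hk
    have hm : MeasurableSet {z : X × ℝ | ENNReal.ofReal z.2 < h z.1} :=
      measurableSet_lt (ENNReal.measurable_ofReal.comp measurable_snd) (hh.comp measurable_fst)
    have hφ : Measurable fun l : ℝ => ENNReal.ofReal (s * l ^ (s - 1)) := by fun_prop
    have e1 : ∀ x, k x * ∫⁻ l in Ioi (0 : ℝ), {l : ℝ | ENNReal.ofReal l < h x}.indicator
        (fun l => ENNReal.ofReal (s * l ^ (s - 1))) l =
        ∫⁻ l in Ioi (0 : ℝ), {z : X × ℝ | ENNReal.ofReal z.2 < h z.1}.indicator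
          (fun z => ENNReal.ofReal (s * z.2 ^ (s - 1)) * k z.1) (x, l) := by
      intro x
      rw [← lintegral_const_mul _ (hφ.indicator
        (measurableSet_lt ENNReal.measurable_ofReal measurable_const))]
      refine lintegral_congr fun l => ?_
      by_cases hl : ENNReal.ofReal l < h x <;> simp [indicator, hl, mul_comm]
    simp_rw [e1]
    rw [lintegral_lintegral_swap]
    · refine lintegral_congr fun l => ?_
      rw [← lintegral_const_mul _ (hk.indicator (measurableSet_lt measurable_const hh))]
      refine lintegral_congr fun x => ?_
      by_cases hl : ENNReal.ofReal l < h x <;> simp [indicator, hl]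
    · exact (((hφ.comp measurable_snd).mul (hk.comp measurable_fst)).indicator hm).aemeasurable
  have h1 : ∫⁻ x, umax μ f x ^ p ∂μ = ∫⁻ l in Ioi (0 : ℝ), ENNReal.ofReal (p * l ^ (p - 1)) *
      μ {x | ENNReal.ofReal l < umax μ f x} := by
    have := swap p (umax μ f) (fun _ => 1) hM measurable_const
    simp_rw [one_mul, lintegral_rpow_indicator hp0] at this
    rw [this]
    refine lintegral_congr fun l => ?_
    rw [lintegral_indicator (measurableSet_lt measurable_const hM), setLIntegral_one]
  have h2 : ∫⁻ x, f x * (2 * f x) ^ (p - 1) ∂μ = ∫⁻ l in Ioi (0 : ℝ),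
      ENNReal.ofReal ((p - 1) * l ^ (p - 1 - 1)) *
      ∫⁻ x, {x | ENNReal.ofReal l < 2 * f x}.indicator f x ∂μ := by
    have := swap (p - 1) (fun x => 2 * f x) f (hf.const_mul 2) hf
    simp_rw [lintegral_rpow_indicator hp1] at this
    exact this
  have h3 : ∫⁻ x, f x * (2 * f x) ^ (p - 1) ∂μ = 2 ^ (p - 1) * ∫⁻ x, f x ^ p ∂μ := by
    rw [← lintegral_const_mul _ (hf.pow_const p)]
    refine lintegral_congr fun x => ?_
    rw [ENNReal.mul_rpow_of_nonneg _ _ hp1.le, mul_left_comm]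
    congr 1
    conv_lhs => rw [← ENNReal.rpow_one (f x)]
    rw [← ENNReal.rpow_mul, one_mul, ← ENNReal.rpow_add_of_nonneg _ _ zero_le_one hp1.le]
    congr 1; ring
  have h4 : ∀ l ∈ Ioi (0 : ℝ), ENNReal.ofReal (p * l ^ (p - 1)) *
      μ {x | ENNReal.ofReal l < umax μ f x} ≤ (2 * D * ENNReal.ofReal (p / (p - 1))) *
        (ENNReal.ofReal ((p - 1) * l ^ (p - 1 - 1)) *
      ∫⁻ x, {x | ENNReal.ofReal l < 2 * f x}.indicator f x ∂μ) := by
    intro l hl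
    have hl : 0 < l := hl
    -- One factor `l` is spent on the weak type bound; what remains is the layer-cake density for
    -- exponent p - 1.
    have e : p * l ^ (p - 1) = (p / (p - 1)) * ((p - 1) * l ^ (p - 1 - 1)) * l := by
      rw [Real.rpow_sub_one hl.ne' (p - 1)]; field_simp
    rw [e, ENNReal.ofReal_mul (by positivity), ENNReal.ofReal_mul (by positivity), mul_assoc]
    calc _ ≤ _ := mul_le_mul_right (hμ.mul_measure_lt_umax_le_setLIntegral hf (ENNReal.ofReal l)) _
      _ = _ := by ring
  rw [h1]
  calc _ ≤ ∫⁻ l in Ioi (0 : ℝ), (2 * D * ENNReal.ofReal (p / (p - 1))) *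
        (ENNReal.ofReal ((p - 1) * l ^ (p - 1 - 1)) *
      ∫⁻ x, {x | ENNReal.ofReal l < 2 * f x}.indicator f x ∂μ) :=
        setLIntegral_mono' measurableSet_Ioi h4
    _ = (2 * D * ENNReal.ofReal (p / (p - 1))) * (2 ^ (p - 1) * ∫⁻ x, f x ^ p ∂μ) := by
        rw [lintegral_const_mul', ← h2, h3]
        finiteness
    _ = _ := by
        push_cast
        rw [ENNReal.coe_rpow_of_nonneg _ hp1.le, ENNReal.ofReal]
        push_cast
        ring

end Strong

/-! ### Control of Lebesgue averages, and doubling. -/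

theorem volume_ball_ne_zero (c : Rn n) {r : ℝ} (hr : 0 < r) : volume (ball c r) ≠ 0 :=
  (measure_ball_pos volume c hr).ne'

theorem volume_ball_ne_top (c : Rn n) (r : ℝ) : volume (ball c r) ≠ ∞ :=
  measure_ball_lt_top.ne

theorem volume_ball_mul (c d : Rn n) {a r : ℝ} (ha : 0 < a) :
    volume (ball c (a * r)) = ENNReal.ofReal (a ^ n) * volume (ball d r) := by
  rw [Measure.addHaar_ball_mul_of_pos volume c ha, Measure.addHaar_ball_center volume d,
    finrank_euclideanSpace, Fintype.card_fin]

/-- A measure `ν` for which the averages over balls with respect to Lebesgue measure are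
controlled by the `L^p(ν)` averages. -/
structure ControlsAverages (p : ℝ) (ν : Measure (Rn n)) (K : ℝ≥0) : Prop where
  pos : ∀ (c : Rn n) (r : ℝ), 0 < r → ν (ball c r) ≠ 0
  fin : ∀ (c : Rn n) (r : ℝ), ν (ball c r) ≠ ∞
  le : ∀ g : Rn n → ℝ≥0∞, Measurable g → ∀ (c : Rn n) (r : ℝ), 0 < r →
    (⨍⁻ y in ball c r, g y ∂volume) ^ p * ν (ball c r) ≤ K * ∫⁻ y in ball c r, g y ^ p ∂ν

/-- Test the hypothesis on the indicator of the small ball: its average over the ball of six times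
the radius is 6^{-n}. -/
theorem ControlsAverages.isDoubling {p : ℝ} {ν : Measure (Rn n)} {K : ℝ≥0} (hp : 0 < p)
    (h : ControlsAverages p ν K) : ∃ D : ℝ≥0, IsDoubling ν D := by
  refine ⟨((6 ^ n : ℝ≥0) ^ p) * K, h.pos, h.fin, fun c r hr => ?_⟩
  have h6 : 0 < 6 * r := by positivity
  have hsub : ball c r ⊆ ball c (6 * r) := ball_subset_ball (by linarith)
  have key := h.le ((ball c r).indicator fun _ => 1) (measurable_const.indicator measurableSet_ball)
    c (6 * r) h6
  have e1 : ⨍⁻ y in ball c (6 * r), (ball c r).indicator (fun _ => (1 : ℝ≥0∞)) y ∂volume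
      = ((6 : ℝ≥0∞) ^ n)⁻¹ := by
    rw [setLAverage_eq, lintegral_indicator measurableSet_ball, setLIntegral_one,
      Measure.restrict_apply measurableSet_ball, inter_eq_self_of_subset_left hsub,
      volume_ball_mul c c (by norm_num : (0 : ℝ) < 6), ENNReal.ofReal_pow (by norm_num),
      ENNReal.ofReal_ofNat, ENNReal.div_eq_inv_mul, ENNReal.mul_inv (by simp) (by simp), mul_assoc,
      ENNReal.inv_mul_cancel (volume_ball_ne_zero c hr) (volume_ball_ne_top c r), mul_one]
  have e2 : ∫⁻ y in ball c (6 * r), (ball c r).indicator (fun _ => (1 : ℝ≥0∞)) y ^ p ∂ν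
      = ν (ball c r) := by
    have : ∀ y, (ball c r).indicator (fun _ => (1 : ℝ≥0∞)) y ^ p =
        (ball c r).indicator (fun _ => (1 : ℝ≥0∞)) y := by
      intro y
      by_cases hy : y ∈ ball c r
      · simp only [indicator_of_mem hy, ENNReal.one_rpow]
      · simp only [indicator_of_notMem hy, ENNReal.zero_rpow_of_pos hp]
    simp_rw [this]
    rw [lintegral_indicator measurableSet_ball, setLIntegral_one,
      Measure.restrict_apply measurableSet_ball, inter_eq_self_of_subset_left hsub]
  rw [e1, e2, ENNReal.inv_rpow] at key
  have hz : ((6 : ℝ≥0∞) ^ n) ^ p ≠ 0 := by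
    simp [ENNReal.rpow_eq_zero_iff, not_lt.2 hp.le]
  have ht : ((6 : ℝ≥0∞) ^ n) ^ p ≠ ∞ := ENNReal.rpow_ne_top_of_nonneg hp.le (by simp)
  calc ν (ball c (6 * r)) = ((6 : ℝ≥0∞) ^ n) ^ p *
        ((((6 : ℝ≥0∞) ^ n) ^ p)⁻¹ * ν (ball c (6 * r))) := by
        rw [← mul_assoc, ENNReal.mul_inv_cancel hz ht, one_mul]
    _ ≤ ((6 : ℝ≥0∞) ^ n) ^ p * (K * ν (ball c r)) := mul_le_mul_right key _
    _ = _ := by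
        rw [← mul_assoc]
        congr 1
        push_cast
        rw [ENNReal.coe_rpow_of_nonneg _ hp.le]
        push_cast
        rfl

theorem isDoubling_volume : ∃ D : ℝ≥0, IsDoubling (volume : Measure (Rn n)) D := by
  refine ControlsAverages.isDoubling (p := 1) (K := 1) one_pos
    ⟨fun c r hr => volume_ball_ne_zero c hr, volume_ball_ne_top, fun g _ c r hr => ?_⟩
  simp_rw [ENNReal.rpow_one]
  rw [setLAverage_eq, ENNReal.div_mul_cancel (volume_ball_ne_zero c hr) (volume_ball_ne_top c r)]
  simp

theorem volume_mul_laverage (f : Rn n → ℝ≥0∞) (c : Rn n) {r : ℝ} (hr : 0 < r) :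
    volume (ball c r) * ⨍⁻ y in ball c r, f y ∂volume = ∫⁻ y in ball c r, f y :=
  isDoubling_volume.choose_spec.mul_laverage f c hr

/-! ### Dual pairs of weights and Muckenhoupt's theorem. -/

/-- An everywhere positive and finite measurable function, integrable on balls. -/
structure IsRegularWeight (W : Rn n → ℝ≥0∞) : Prop where
  measurable : Measurable W
  ne_zero : ∀ x, W x ≠ 0
  ne_top : ∀ x, W x ≠ ∞
  fin : ∀ (c : Rn n) (r : ℝ), volume.withDensity W (ball c r) ≠ ∞

theorem IsRegularWeight.absolutelyContinuous {W : Rn n → ℝ≥0∞} (hW : IsRegularWeight W) :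
    volume ≪ volume.withDensity W :=
  withDensity_absolutelyContinuous' hW.measurable.aemeasurable
    (Filter.Eventually.of_forall hW.ne_zero)

theorem IsRegularWeight.pos {W : Rn n → ℝ≥0∞} (hW : IsRegularWeight W) (c : Rn n) (r : ℝ)
    (hr : 0 < r) : volume.withDensity W (ball c r) ≠ 0 := fun h =>
  volume_ball_ne_zero c hr (hW.absolutelyContinuous h)

theorem IsRegularWeight.setLIntegral {W : Rn n → ℝ≥0∞} (hW : IsRegularWeight W)
    {f : Rn n → ℝ≥0∞} (hf : Measurable f) {s : Set (Rn n)} (hs : MeasurableSet s) :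
    ∫⁻ x in s, f x ∂volume.withDensity W = ∫⁻ x in s, W x * f x := by
  rw [setLIntegral_withDensity_eq_setLIntegral_mul _ hW.measurable hf hs]
  rfl

theorem IsRegularWeight.lintegral {W : Rn n → ℝ≥0∞} (hW : IsRegularWeight W)
    {f : Rn n → ℝ≥0∞} (hf : Measurable f) :
    ∫⁻ x, f x ∂volume.withDensity W = ∫⁻ x, W x * f x := by
  rw [lintegral_withDensity_eq_lintegral_mul _ hW.measurable hf]
  rfl

/-- A weight `W` and its dual `S = W^{1-q}`, subject to the `A_p` condition. -/
structure IsDualPair (p q : ℝ) (W S : Rn n → ℝ≥0∞) (K : ℝ≥0) : Prop where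
  conj : p.HolderConjugate q
  left : IsRegularWeight W
  right : IsRegularWeight S
  mul : ∀ x, W x ^ (1 / p) * S x ^ (1 / q) = 1
  le : ∀ (c : Rn n) (r : ℝ), 0 < r → volume.withDensity W (ball c r) ^ (1 / p) *
    volume.withDensity S (ball c r) ^ (1 / q) ≤ K * volume (ball c r)

section

variable {p q : ℝ} {W S : Rn n → ℝ≥0∞} {K : ℝ≥0}

theorem IsDualPair.symm (h : IsDualPair p q W S K) : IsDualPair q p S W K :=
  ⟨h.conj.symm, h.right, h.left, fun x => by rw [mul_comm]; exact h.mul x,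
    fun c r hr => by rw [mul_comm]; exact h.le c r hr⟩

theorem IsDualPair.rpow_mul_rpow (h : IsDualPair p q W S K) (x : Rn n) :
    W x ^ (-q) * W x = S x := by
  have hq : 0 < q := h.conj.symm.pos
  have hp : 0 < p := h.conj.pos
  have h1 : W x ^ (q - 1) * S x = 1 := by
    have := congrArg (· ^ q) (h.mul x)
    simp only [ENNReal.one_rpow] at this
    rw [ENNReal.mul_rpow_of_nonneg _ _ hq.le, ← ENNReal.rpow_mul, ← ENNReal.rpow_mul,
      one_div_mul_cancel hq.ne', ENNReal.rpow_one] at this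
    rwa [one_div_mul_eq_div, h.conj.symm.div_conj_eq_sub_one] at this
  have h0 := h.left.ne_zero x
  have ht := h.left.ne_top x
  calc W x ^ (-q) * W x = W x ^ (-q) * W x * (W x ^ (q - 1) * S x) := by rw [h1, mul_one]
    _ = (W x ^ (-q) * W x ^ (1 : ℝ) * W x ^ (q - 1)) * S x := by rw [ENNReal.rpow_one]; ring
    _ = S x := by
        rw [← ENNReal.rpow_add _ _ h0 ht, ← ENNReal.rpow_add _ _ h0 ht]
        simp

/-- Hölder for the factorisation g = (W^{1/p} g) S^{1/q}; the A_p condition then absorbs the mass of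
`S`. -/
theorem IsDualPair.controlsAverages (h : IsDualPair p q W S K) :
    ControlsAverages p (volume.withDensity W) (K ^ p) := by
  refine ⟨h.left.pos, h.left.fin, fun g hg c r hr => ?_⟩
  have hp : 0 < p := h.conj.pos
  have hq : 0 < q := h.conj.symm.pos
  set B := ball c r
  have hB0 : volume B ≠ 0 := volume_ball_ne_zero c hr
  have hBt : volume B ≠ ∞ := volume_ball_ne_top c r
  have holder : ∫⁻ y in B, g y ≤ (∫⁻ y in B, g y ^ p ∂volume.withDensity W) ^ (1 / p) *
      (volume.withDensity S B) ^ (1 / q) := by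
    have := ENNReal.lintegral_mul_le_Lp_mul_Lq (volume.restrict B) h.conj
      (f := fun y => W y ^ (1 / p) * g y) (g := fun y => S y ^ (1 / q))
      ((h.left.measurable.pow_const _).mul hg).aemeasurable
      (h.right.measurable.pow_const _).aemeasurable
    rw [h.left.setLIntegral (hg.pow_const p) measurableSet_ball,
      withDensity_apply _ measurableSet_ball]
    convert this using 3 with y
    · simp only [Pi.mul_apply]
      rw [mul_right_comm, h.mul y, one_mul]
    · refine lintegral_congr fun y => ?_
      rw [ENNReal.mul_rpow_of_nonneg _ _ hp.le, ← ENNReal.rpow_mul, one_div_mul_cancel hp.ne',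
        ENNReal.rpow_one]
    · refine lintegral_congr fun y => ?_
      rw [← ENNReal.rpow_mul, one_div_mul_cancel hq.ne', ENNReal.rpow_one]
  set I := ∫⁻ y in B, g y ^ p ∂volume.withDensity W
  have main : (⨍⁻ y in B, g y ∂volume) * volume.withDensity W B ^ (1 / p) ≤ K * I ^ (1 / p) := by
    rw [setLAverage_eq, ENNReal.div_eq_inv_mul, mul_assoc]
    calc (volume B)⁻¹ * ((∫⁻ y in B, g y) * volume.withDensity W B ^ (1 / p))
        ≤ (volume B)⁻¹ * ((I ^ (1 / p) * volume.withDensity S B ^ (1 / q)) *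
          volume.withDensity W B ^ (1 / p)) := by gcongr
      _ = (volume B)⁻¹ * (volume.withDensity W B ^ (1 / p) * volume.withDensity S B ^ (1 / q)) *
          I ^ (1 / p) := by ring
      _ ≤ (volume B)⁻¹ * (K * volume B) * I ^ (1 / p) :=
          mul_le_mul_left (mul_le_mul_right (h.le c r hr) _) _
      _ = K * ((volume B)⁻¹ * volume B) * I ^ (1 / p) := by ring
      _ = _ := by rw [ENNReal.inv_mul_cancel hB0 hBt, mul_one]
  have := ENNReal.rpow_le_rpow main hp.le
  rwa [ENNReal.mul_rpow_of_nonneg _ _ hp.le, ENNReal.mul_rpow_of_nonneg _ _ hp.le,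
    ← ENNReal.rpow_mul, ← ENNReal.rpow_mul, one_div_mul_cancel hp.ne', ENNReal.rpow_one,
    ENNReal.rpow_one, ← ENNReal.coe_rpow_of_nonneg _ hp.le] at this

/-- Lerner's pointwise estimate of the maximal function by weighted maximal functions. -/
theorem IsDualPair.umax_le (h : IsDualPair p q W S K) {f : Rn n → ℝ≥0∞} (hf : Measurable f)
    (x : Rn n) :
    umax volume f x ≤ (K : ℝ≥0∞) ^ q * umax (volume.withDensity W)
      (fun y => umax (volume.withDensity S) (fun z => f z / S z) y ^ (p - 1) / W y) x
        ^ (q - 1) := by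
  have hp1 : 0 < p - 1 := h.conj.sub_one_pos
  have hq1 : 0 < q - 1 := h.conj.symm.sub_one_pos
  have hq : 0 < q := h.conj.symm.pos
  have hp : 0 < p := h.conj.pos
  obtain ⟨D, hD⟩ := h.controlsAverages.isDoubling h.conj.pos
  obtain ⟨D', hD'⟩ := h.symm.controlsAverages.isDoubling hq
  set k : Rn n → ℝ≥0∞ := fun y =>
    umax (volume.withDensity S) (fun z => f z / S z) y ^ (p - 1) / W y with hk
  set G := umax (volume.withDensity W) k x
  refine Amalgam.umax_le fun c r hx => ?_
  have hr := pos_of_mem_ball hx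
  set B := ball c r
  have hB0 : volume B ≠ 0 := volume_ball_ne_zero c hr
  have hBt : volume B ≠ ∞ := volume_ball_ne_top c r
  set A := ⨍⁻ y in B, f y / S y ∂volume.withDensity S
  have hm : Measurable k := ((measurable_umax _ _).pow_const _).div h.left.measurable
  have h1 : volume.withDensity S B * A = ∫⁻ y in B, f y := by
    have hfS : Measurable fun y => f y / S y := hf.div h.right.measurable
    rw [hD'.mul_laverage _ c hr, h.right.setLIntegral hfS measurableSet_ball]
    refine lintegral_congr fun y => ENNReal.mul_div_cancel (h.right.ne_zero y) (h.right.ne_top y)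
  -- On `B` the constant `A` is dominated by the `S`-maximal function. Dividing and multiplying by
  -- `W` turns the resulting Lebesgue integral into a `W`-average, hence brings in the second
  -- maximal function.
  have h2 : A ^ (p - 1) * volume B ≤ volume.withDensity W B * G := by
    calc A ^ (p - 1) * volume B = ∫⁻ _ in B, A ^ (p - 1) := by rw [setLIntegral_const]
      _ ≤ ∫⁻ y in B, umax (volume.withDensity S) (fun z => f z / S z) y ^ (p - 1) := by
          refine setLIntegral_mono' measurableSet_ball fun y hy => ?_
          exact ENNReal.rpow_le_rpow (laverage_le_umax _ _ hy) hp1.le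
      _ = ∫⁻ y in B, k y ∂volume.withDensity W := by
          rw [h.left.setLIntegral hm measurableSet_ball]
          exact lintegral_congr fun y =>
            (ENNReal.mul_div_cancel (h.left.ne_zero y) (h.left.ne_top y)).symm
      _ = volume.withDensity W B * ⨍⁻ y in B, k y ∂volume.withDensity W :=
          (hD.mul_laverage _ c hr).symm
      _ ≤ _ := mul_le_mul_right (laverage_le_umax _ _ hx) _
  have hpq : (p - 1) * (q - 1) = 1 := by
    have := h.conj.mul_eq_add
    linarith
  have h3 : A * volume B ^ (q - 1) ≤ volume.withDensity W B ^ (q - 1) * G ^ (q - 1) := by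
    have := ENNReal.rpow_le_rpow h2 hq1.le
    rwa [ENNReal.mul_rpow_of_nonneg _ _ hq1.le, ENNReal.mul_rpow_of_nonneg _ _ hq1.le,
      ← ENNReal.rpow_mul, hpq, ENNReal.rpow_one] at this
  have h4 : volume.withDensity S B * volume.withDensity W B ^ (q - 1) ≤
      (K : ℝ≥0∞) ^ q * (volume B ^ (q - 1) * volume B) := by
    have := ENNReal.rpow_le_rpow (h.le c r hr) hq.le
    rw [ENNReal.mul_rpow_of_nonneg _ _ hq.le, ENNReal.mul_rpow_of_nonneg _ _ hq.le,
      ← ENNReal.rpow_mul, ← ENNReal.rpow_mul, one_div_mul_cancel hq.ne', ENNReal.rpow_one] at this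
    have e : 1 / p * q = q - 1 := by rw [one_div_mul_eq_div, h.conj.symm.div_conj_eq_sub_one]
    have e2 : volume B ^ q = volume B ^ (q - 1) * volume B := by
      conv_rhs => rw [← ENNReal.rpow_one (volume B), ← ENNReal.rpow_mul, one_mul,
        ← ENNReal.rpow_add _ _ hB0 hBt, sub_add_cancel]
    rw [e, e2] at this
    rwa [mul_comm]
  -- The integral of `f` is `A` times the `S`-mass of `B`; `h3` bounds `A`, and `h4` trades the two
  -- weighted masses for Lebesgue measure.
  have h5 : volume B ^ (q - 1) * ∫⁻ y in B, f y ≤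
      volume B ^ (q - 1) * ((K : ℝ≥0∞) ^ q * G ^ (q - 1) * volume B) := by
    rw [← h1]
    calc _ = volume.withDensity S B * (A * volume B ^ (q - 1)) := by ring
      _ ≤ volume.withDensity S B * (volume.withDensity W B ^ (q - 1) * G ^ (q - 1)) := by gcongr
      _ = volume.withDensity S B * volume.withDensity W B ^ (q - 1) * G ^ (q - 1) := by ring
      _ ≤ (K : ℝ≥0∞) ^ q * (volume B ^ (q - 1) * volume B) * G ^ (q - 1) := by gcongr
      _ = _ := by ring
  rw [setLAverage_eq]
  refine ENNReal.div_le_of_le_mul ?_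
  refine (ENNReal.mul_le_mul_iff_right ?_ ?_).1 h5
  · simp [ENNReal.rpow_eq_zero_iff, hB0, hBt]
  · exact ENNReal.rpow_ne_top_of_nonneg hq1.le hBt

/-- Muckenhoupt's theorem. -/
theorem IsDualPair.lintegral_umax_rpow_le (h : IsDualPair p q W S K) :
    ∃ C : ℝ≥0, ∀ f : Rn n → ℝ≥0∞, Measurable f →
      ∫⁻ x, umax volume f x ^ p ∂volume.withDensity W ≤
        C * ∫⁻ x, f x ^ p ∂volume.withDensity W := by
  have hp1 : 0 < p - 1 := h.conj.sub_one_pos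
  have hq1 : 0 < q - 1 := h.conj.symm.sub_one_pos
  have hq : 0 < q := h.conj.symm.pos
  have hp : 0 < p := h.conj.pos
  obtain ⟨D, hD⟩ := h.controlsAverages.isDoubling h.conj.pos
  obtain ⟨D', hD'⟩ := h.symm.controlsAverages.isDoubling hq
  -- Since (q - 1)p = q, the outer `W`-maximal function is needed on L^q(W), and the inner
  -- `S`-maximal function on L^p(S).
  obtain ⟨C₁, h₁⟩ := hD.lintegral_umax_rpow_le h.conj.symm.lt
  obtain ⟨C₂, h₂⟩ := hD'.lintegral_umax_rpow_le h.conj.lt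
  refine ⟨(K ^ q) ^ p * (C₁ * C₂), fun f hf => ?_⟩
  set M := umax (volume.withDensity S) (fun z => f z / S z)
  have hM : Measurable M := measurable_umax _ _
  have hpq : (q - 1) * p = q := by
    have := h.conj.mul_eq_add
    linarith
  have hpq' : (p - 1) * q = p := by
    have := h.conj.mul_eq_add
    linarith
  have e1 : ∫⁻ x, (M x ^ (p - 1) / W x) ^ q ∂volume.withDensity W =
      ∫⁻ x, M x ^ p ∂volume.withDensity S := by
    have hm : Measurable fun x => (M x ^ (p - 1) / W x) ^ q :=
      ((hM.pow_const _).div h.left.measurable).pow_const _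
    rw [h.left.lintegral hm,
      h.right.lintegral (hM.pow_const _)]
    refine lintegral_congr fun x => ?_
    rw [ENNReal.div_rpow_of_nonneg _ _ hq.le, ← ENNReal.rpow_mul, hpq', div_eq_mul_inv,
      ← ENNReal.rpow_neg, ← h.rpow_mul_rpow x]
    ring
  have e2 : ∫⁻ x, (f x / S x) ^ p ∂volume.withDensity S =
      ∫⁻ x, f x ^ p ∂volume.withDensity W := by
    have hm : Measurable fun x => (f x / S x) ^ p := (hf.div h.right.measurable).pow_const _
    rw [h.right.lintegral hm,
      h.left.lintegral (hf.pow_const _)]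
    refine lintegral_congr fun x => ?_
    rw [ENNReal.div_rpow_of_nonneg _ _ hp.le, div_eq_mul_inv,
      ← ENNReal.rpow_neg, ← h.symm.rpow_mul_rpow x]
    ring
  calc ∫⁻ x, umax volume f x ^ p ∂volume.withDensity W
      ≤ ∫⁻ x, ((K : ℝ≥0∞) ^ q) ^ p * umax (volume.withDensity W)
          (fun y => M y ^ (p - 1) / W y) x ^ q ∂volume.withDensity W := by
        refine lintegral_mono fun x => ?_
        refine (ENNReal.rpow_le_rpow (h.umax_le hf x) hp.le).trans_eq ?_
        rw [ENNReal.mul_rpow_of_nonneg _ _ hp.le, ← ENNReal.rpow_mul _ (q - 1), hpq]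
    _ = ((K : ℝ≥0∞) ^ q) ^ p * ∫⁻ x, umax (volume.withDensity W)
          (fun y => M y ^ (p - 1) / W y) x ^ q ∂volume.withDensity W :=
        lintegral_const_mul _ ((measurable_umax _ _).pow_const _)
    _ ≤ ((K : ℝ≥0∞) ^ q) ^ p * (C₁ * ∫⁻ x, M x ^ p ∂volume.withDensity S) := by
        rw [← e1]
        exact mul_le_mul_right (h₁ _ ((hM.pow_const _).div h.left.measurable)) _
    _ ≤ ((K : ℝ≥0∞) ^ q) ^ p * (C₁ * (C₂ * ∫⁻ x, f x ^ p ∂volume.withDensity W)) := by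
        rw [← e2]
        gcongr
        exact h₂ _ (hf.div h.right.measurable)
    _ = _ := by
        push_cast
        rw [ENNReal.coe_rpow_of_nonneg _ hp.le, ENNReal.coe_rpow_of_nonneg _ hq.le]
        ring

end

/-! ### Semicontinuity and measurability of ball averages. -/

theorem isOpen_lt_measure_ball {X : Type*} [PseudoMetricSpace X] [MeasurableSpace X]
    (μ : Measure X) (r : ℝ) (a : ℝ≥0∞) : IsOpen {x | a < μ (ball x r)} := by
  rw [isOpen_iff_forall_mem_open]
  intro x hx
  -- By continuity from below a slightly smaller concentric ball still has mass above `a`, and it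
  -- lies in every ball of radius `r` with nearby centre.
  have hU : ball x r = ⋃ k : ℕ, ball x (r - 1 / (k + 1)) := by
    ext y
    simp only [mem_ball, mem_iUnion]
    constructor
    · intro h
      obtain ⟨k, hk⟩ := exists_nat_one_div_lt (sub_pos.2 h)
      exact ⟨k, by linarith⟩
    · rintro ⟨k, hk⟩
      have : (0 : ℝ) < 1 / (k + 1) := by positivity
      linarith
  have hmono : Monotone fun k : ℕ => ball x (r - 1 / (k + 1)) := fun k l hkl =>
    ball_subset_ball (sub_le_sub_left (Nat.one_div_le_one_div hkl) r)
  have hx' : a < μ (ball x r) := hx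
  rw [hU, hmono.measure_iUnion, lt_iSup_iff] at hx'
  obtain ⟨k, hk⟩ := hx'
  refine ⟨ball x (1 / (k + 1)), fun y hy => ?_, isOpen_ball,
    mem_ball_self (by positivity)⟩
  refine hk.trans_le (measure_mono (ball_subset_ball' ?_))
  have := mem_ball'.1 hy
  linarith

theorem measurable_measure_ball {X : Type*} [PseudoMetricSpace X] [MeasurableSpace X]
    [OpensMeasurableSpace X] (μ : Measure X) (r : ℝ) : Measurable fun x => μ (ball x r) :=
  measurable_of_Ioi fun a => (isOpen_lt_measure_ball μ r a).measurableSet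

theorem measurable_setLIntegral_ball {X : Type*} [PseudoMetricSpace X] [MeasurableSpace X]
    [OpensMeasurableSpace X] (μ : Measure X) (f : X → ℝ≥0∞) (r : ℝ) :
    Measurable fun x => ∫⁻ y in ball x r, f y ∂μ := by
  have := measurable_measure_ball (μ.withDensity f) r
  simpa only [withDensity_apply _ measurableSet_ball] using this

theorem measurable_laverage_ball {X : Type*} [PseudoMetricSpace X] [MeasurableSpace X]
    [OpensMeasurableSpace X] (μ : Measure X) (f : X → ℝ≥0∞) (r : ℝ) :
    Measurable fun x => ⨍⁻ y in ball x r, f y ∂μ := by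
  simp_rw [setLAverage_eq]
  exact (measurable_setLIntegral_ball μ f r).div (measurable_measure_ball μ r)

/-- Lebesgue measure of a ball does not depend on the centre, so at each radius the average inherits
the lower semicontinuity of the integral. -/
theorem isOpen_lt_maximal {F : Type*} [ENorm F] (f : Rn n → F) (a : ℝ≥0∞) :
    IsOpen {x | a < maximal f x} := by
  have h : {x | a < maximal f x} = ⋃ (r : ℝ) (_ : 0 < r),
      {x | a * volume (ball (0 : Rn n) r) < volume.withDensity (fun y => ‖f y‖ₑ) (ball x r)} := by
    ext x
    simp only [maximal, mem_ofPred_eq, lt_iSup_iff, mem_iUnion]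
    refine exists_congr fun r => exists_congr fun hr => ?_
    rw [setLAverage_eq, withDensity_apply _ measurableSet_ball,
      Measure.addHaar_ball_center volume x r,
      ENNReal.lt_div_iff_mul_lt (Or.inl (volume_ball_ne_zero _ hr))
        (Or.inl (volume_ball_ne_top _ _))]
  rw [h]
  exact isOpen_iUnion fun r => isOpen_iUnion fun _ => isOpen_lt_measure_ball _ _ _

theorem measurable_maximal {F : Type*} [ENorm F] (f : Rn n → F) : Measurable (maximal f) :=
  measurable_of_Ioi fun a => (isOpen_lt_maximal f a).measurableSet

theorem laverage_le_maximal (g : Rn n → ℝ≥0∞) (x : Rn n) {r : ℝ} (hr : 0 < r) :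
    ⨍⁻ y in ball x r, g y ∂volume ≤ maximal g x :=
  le_iSup₂_of_le (f := fun (r : ℝ) (_ : 0 < r) => ⨍⁻ y in ball x r, ‖g y‖ₑ ∂volume) r hr le_rfl

theorem umax_le_essSup (f : Rn n → ℝ≥0∞) (x : Rn n) :
    umax volume f x ≤ essSup f volume := by
  refine umax_le fun c r hx => ?_
  have hr := pos_of_mem_ball hx
  rw [setLAverage_eq]
  refine ENNReal.div_le_of_le_mul ?_
  calc ∫⁻ y in ball c r, f y ≤ ∫⁻ _ in ball c r, essSup f volume :=
        lintegral_mono_ae (ae_restrict_of_ae (ENNReal.ae_le_essSup f))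
    _ = _ := setLIntegral_const _ _

theorem ControlsAverages.laverage_le {p : ℝ} {ν : Measure (Rn n)} {K : ℝ≥0} (hp : 0 < p)
    (h : ControlsAverages p ν K) {g : Rn n → ℝ≥0∞} (hg : Measurable g) (c : Rn n) {r : ℝ}
    (hr : 0 < r) : ⨍⁻ y in ball c r, g y ∂volume ≤
      (K : ℝ≥0∞) ^ (1 / p) * (⨍⁻ y in ball c r, g y ^ p ∂ν) ^ (1 / p) := by
  have h1 : (⨍⁻ y in ball c r, g y ∂volume) ^ p ≤ K * ⨍⁻ y in ball c r, g y ^ p ∂ν := by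
    rw [setLAverage_eq (μ := ν), ← mul_div_assoc,
      ENNReal.le_div_iff_mul_le (Or.inl (h.pos c r hr)) (Or.inl (h.fin c r))]
    exact h.le g hg c r hr
  have := ENNReal.rpow_le_rpow h1 (one_div_nonneg.2 hp.le)
  rwa [← ENNReal.rpow_mul, mul_one_div_cancel hp.ne', ENNReal.rpow_one,
    ENNReal.mul_rpow_of_nonneg _ _ (one_div_nonneg.2 hp.le)] at this

/-! ### Splitting the maximal function at scale t. -/

theorem lintegral_mul_setLIntegral_ball_comm {h f : Rn n → ℝ≥0∞} (hh : Measurable h)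
    (hf : Measurable f) (t : ℝ) :
    ∫⁻ u, h u * (∫⁻ z in ball u t, f z) = ∫⁻ z, f z * (∫⁻ u in ball z t, h u) := by
  have hm : MeasurableSet {a : Rn n × Rn n | dist a.1 a.2 < t} :=
    measurableSet_lt measurable_dist measurable_const
  have e : ∀ (h f : Rn n → ℝ≥0∞), Measurable f → ∀ u, h u * (∫⁻ z in ball u t, f z) =
      ∫⁻ z, {a : Rn n × Rn n | dist a.1 a.2 < t}.indicator (fun a => h a.1 * f a.2) (u, z) := by
    intro h f hf u
    rw [← lintegral_indicator measurableSet_ball,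
      ← lintegral_const_mul _ (hf.indicator measurableSet_ball)]
    refine lintegral_congr fun z => ?_
    by_cases hz : dist u z < t <;> simp [indicator, hz, mem_ball, dist_comm z u]
  simp_rw [e h f hf, e f h hh]
  rw [lintegral_lintegral_swap]
  · refine lintegral_congr fun z => lintegral_congr fun u => ?_
    by_cases hz : dist u z < t <;> simp [indicator, hz, dist_comm z u, mul_comm]
  · exact (((hh.comp measurable_fst).mul (hf.comp measurable_snd)).indicator hm).aemeasurable

/-- Averages over balls of radius larger than `t` are controlled by averages of the averages
over balls of radius `t`. -/
theorem laverage_le_of_lt {g F : Rn n → ℝ≥0∞} (hg : Measurable g) {t r : ℝ} (ht : 0 < t)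
    (htr : t < r) {k : ℝ≥0∞}
    (hF : ∀ u, ⨍⁻ z in ball u t, g z ∂volume ≤ k * F u) (hFm : Measurable F) {x y : Rn n}
    (hxy : y ∈ ball x t) :
    ⨍⁻ z in ball y r, g z ∂volume ≤ k * 2 ^ n * umax volume F x := by
  have hr : 0 < r := ht.trans htr
  set b := volume (ball (0 : Rn n) t)
  have hb : ∀ u : Rn n, volume (ball u t) = b := fun u => Measure.addHaar_ball_center volume u t
  have hb0 : b ≠ 0 := volume_ball_ne_zero _ ht
  have hbt : b ≠ ∞ := volume_ball_ne_top _ _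
  have hx : x ∈ ball y (2 * r) := by
    have := mem_ball'.1 hxy
    exact mem_ball.2 (by linarith)
  -- For z in B(y,r) the ball B(z,t) stays inside B(y,2r), as t < r. Writing `b` as its measure and
  -- applying Tonelli replaces `g` by its integrals at scale t.
  have h1 : b * ∫⁻ z in ball y r, g z ≤ b * (k * ∫⁻ u in ball y (2 * r), F u) := by
    calc b * ∫⁻ z in ball y r, g z = ∫⁻ z in ball y r, g z * b := by
          rw [lintegral_mul_const _ hg, mul_comm]
      _ ≤ ∫⁻ z in ball y r, g z *
          (∫⁻ u in ball z t, (ball y (2 * r)).indicator (fun _ => 1) u) := by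
          refine setLIntegral_mono' measurableSet_ball fun z hz => ?_
          gcongr
          have hsub : ball z t ⊆ ball y (2 * r) := ball_subset_ball' (by
            have := mem_ball.1 hz
            linarith)
          rw [lintegral_indicator measurableSet_ball, setLIntegral_one,
            Measure.restrict_apply measurableSet_ball, inter_eq_self_of_subset_right hsub, hb]
      _ ≤ ∫⁻ z, g z * (∫⁻ u in ball z t, (ball y (2 * r)).indicator (fun _ => 1) u) :=
          setLIntegral_le_lintegral _ _
      _ = ∫⁻ u, (ball y (2 * r)).indicator (fun _ => 1) u * (∫⁻ z in ball u t, g z) :=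
          (lintegral_mul_setLIntegral_ball_comm (measurable_const.indicator measurableSet_ball)
            hg t).symm
      _ = ∫⁻ u in ball y (2 * r), ∫⁻ z in ball u t, g z := by
          rw [← lintegral_indicator measurableSet_ball]
          refine lintegral_congr fun u => ?_
          by_cases hu : u ∈ ball y (2 * r) <;> simp [hu]
      _ ≤ ∫⁻ u in ball y (2 * r), b * k * F u := by
          refine lintegral_mono fun u => ?_
          rw [← volume_mul_laverage g u ht, hb, mul_assoc]
          gcongr
          exact hF u
      _ = _ := by rw [lintegral_const_mul _ hFm, mul_assoc]
  have h2 := (ENNReal.mul_le_mul_iff_right hb0 hbt).1 h1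
  rw [setLAverage_eq]
  refine ENNReal.div_le_of_le_mul (h2.trans ?_)
  rw [← volume_mul_laverage F y (by positivity), volume_ball_mul y y two_pos,
    ENNReal.ofReal_pow zero_le_two, ENNReal.ofReal_ofNat]
  calc _ ≤ k * (2 ^ n * volume (ball y r) * umax volume F x) := by
        gcongr
        exact laverage_le_umax _ _ hx
    _ = _ := by ring

/-- Balls about y of radius at most t lie in B(x,2t), where truncating `g` changes nothing; larger
radii fall under `laverage_le_of_lt`. -/
theorem maximal_le_add {g F : Rn n → ℝ≥0∞} (hg : Measurable g) {t : ℝ} (ht : 0 < t) {k : ℝ≥0∞}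
    (hF : ∀ u, ⨍⁻ z in ball u t, g z ∂volume ≤ k * F u) (hFm : Measurable F) {x y : Rn n}
    (hxy : y ∈ ball x t) :
    maximal g y ≤ umax volume ((ball x (2 * t)).indicator g) y +
      k * 2 ^ n * umax volume F x := by
  refine iSup₂_le fun r hr => ?_
  simp only [enorm_eq_self]
  rcases le_or_gt r t with h | h
  · refine le_trans (le_of_eq ?_) (le_trans (laverage_le_umax volume
      ((ball x (2 * t)).indicator g) (mem_ball_self hr)) le_self_add)
    have hsub : ball y r ⊆ ball x (2 * t) := ball_subset_ball' (by
      have := mem_ball.1 hxy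
      linarith)
    rw [setLAverage_eq, setLAverage_eq]
    congr 1
    exact setLIntegral_congr_fun measurableSet_ball fun z hz => by
      rw [indicator_of_mem (hsub hz)]
  · exact (laverage_le_of_lt hg ht h hF hFm hxy).trans le_add_self

/-! ### Local means and pointwise estimates. -/

/-- The local `L^p(ν)` average at scale `t`. -/
noncomputable def localMean (ν : Measure (Rn n)) (p t : ℝ) (g : Rn n → ℝ≥0∞) (u : Rn n) :
    ℝ≥0∞ :=
  (⨍⁻ y in ball u t, g y ^ p ∂ν) ^ (1 / p)

theorem measurable_localMean (ν : Measure (Rn n)) (p t : ℝ) (g : Rn n → ℝ≥0∞) :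
    Measurable (localMean ν p t g) :=
  (measurable_laverage_ball ν _ t).pow_const _

/-- Compactness at unit scale, then translation and dilation: one set of centres serves all x and t,
so constants stay uniform. -/
theorem exists_finite_cover_ball : ∃ s : Finset (Rn n), (∀ z ∈ s, z ∈ closedBall (0 : Rn n) 2) ∧
    ∀ (x : Rn n) (t : ℝ), 0 < t → ball x (2 * t) ⊆ ⋃ z ∈ s, ball (x + t • z) (t / 2) := by
  obtain ⟨s, hs, hfin, hcov⟩ := (isCompact_closedBall (0 : Rn n) 2).finite_cover_balls
    (by norm_num : (0 : ℝ) < 1 / 2)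
  refine ⟨hfin.toFinset, fun z hz => hs (hfin.mem_toFinset.1 hz), fun x t ht y hy => ?_⟩
  have hy' : ‖y - x‖ < 2 * t := mem_ball_iff_norm.1 hy
  have hmem : t⁻¹ • (y - x) ∈ closedBall (0 : Rn n) 2 := by
    rw [mem_closedBall_zero_iff, norm_smul, norm_inv, Real.norm_of_nonneg ht.le,
      inv_mul_le_iff₀ ht]
    linarith
  obtain ⟨z, hz, hzy⟩ := mem_iUnion₂.1 (hcov hmem)
  refine mem_iUnion₂.2 ⟨z, hfin.mem_toFinset.2 hz, ?_⟩
  rw [mem_ball_iff_norm] at hzy ⊢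
  have : y - (x + t • z) = t • (t⁻¹ • (y - x) - z) := by
    rw [smul_sub, smul_inv_smul₀ ht.ne']; abel
  rw [this, norm_smul, Real.norm_of_nonneg ht.le]
  nlinarith

/-- Cover B(x,2t) by balls of radius t/2. Each lies in B(u,t) for every u in it, so doubling bounds
its integral by the p-th power of the local mean at u, for all such u at once; averaging the local
mean over u gives an L^1 average on the right. -/
theorem setLIntegral_ball_le_mul_laverage_localMean {ν : Measure (Rn n)} {D : ℝ≥0}
    (hν : IsDoubling ν D) {p : ℝ} (hp : 0 < p) : ∃ C : ℝ≥0, ∀ (t : ℝ), 0 < t →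
    ∀ (g : Rn n → ℝ≥0∞) (x : Rn n),
    ∫⁻ y in ball x (2 * t), g y ^ p ∂ν ≤
      C * ν (ball x t) * (⨍⁻ u in ball x (3 * t), localMean ν p t g u ∂volume) ^ p := by
  obtain ⟨s, hs, hcov⟩ := exists_finite_cover_ball (n := n)
  refine ⟨s.card * (D * (6 ^ n) ^ p), fun t ht g x => ?_⟩
  set L := ⨍⁻ u in ball x (3 * t), localMean ν p t g u ∂volume
  have hone : ∀ z ∈ s, ∫⁻ y in ball (x + t • z) (t / 2), g y ^ p ∂ν ≤
      D * (6 ^ n) ^ p * ν (ball x t) * L ^ p := by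
    intro z hz
    set c := x + t • z
    set I := ∫⁻ y in ball c (t / 2), g y ^ p ∂ν
    have hzn : ‖z‖ ≤ 2 := mem_closedBall_zero_iff.1 (hs z hz)
    have hcx : dist c x ≤ 2 * t := by
      rw [dist_eq_norm, add_sub_cancel_left, norm_smul, Real.norm_of_nonneg ht.le]
      nlinarith
    have hν0 := hν.pos x (6 * t) (by positivity)
    have hνt := hν.fin x (6 * t)
    have h1 : ∀ u ∈ ball c (t / 2), (I / ν (ball x (6 * t))) ^ (1 / p) ≤ localMean ν p t g u := by
      intro u hu
      have hu' := mem_ball.1 hu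
      refine ENNReal.rpow_le_rpow ?_ (one_div_nonneg.2 hp.le)
      rw [setLAverage_eq]
      refine ENNReal.div_le_div (lintegral_mono_set (ball_subset_ball' ?_))
        (measure_mono (ball_subset_ball' ?_))
      · rw [dist_comm]; linarith
      · linarith [dist_triangle u c x]
    have h2 : volume (ball c (t / 2)) * (I / ν (ball x (6 * t))) ^ (1 / p) ≤
        volume (ball c (t / 2)) * (6 ^ n * L) := by
      calc _ = ∫⁻ _ in ball c (t / 2), (I / ν (ball x (6 * t))) ^ (1 / p) := by
            rw [setLIntegral_const, mul_comm]
        _ ≤ ∫⁻ u in ball c (t / 2), localMean ν p t g u :=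
            setLIntegral_mono' measurableSet_ball h1
        _ ≤ ∫⁻ u in ball x (3 * t), localMean ν p t g u :=
            lintegral_mono_set (ball_subset_ball' (by linarith))
        _ = volume (ball x (6 * (t / 2))) * L := by
            rw [← volume_mul_laverage _ x (by positivity)]
            congr 3; ring
        _ = _ := by
            rw [volume_ball_mul x c (by norm_num), ENNReal.ofReal_pow (by norm_num),
              ENNReal.ofReal_ofNat]
            ring
    have h3 := (ENNReal.mul_le_mul_iff_right (volume_ball_ne_zero c (by positivity))
      (volume_ball_ne_top c _)).1 h2
    have h4 := ENNReal.rpow_le_rpow h3 hp.le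
    rw [← ENNReal.rpow_mul, one_div_mul_cancel hp.ne', ENNReal.rpow_one,
      ENNReal.mul_rpow_of_nonneg _ _ hp.le, ENNReal.div_le_iff_le_mul (Or.inl hν0) (Or.inl hνt)]
      at h4
    calc I ≤ _ := h4
      _ ≤ (6 ^ n) ^ p * L ^ p * (D * ν (ball x t)) := by gcongr; exact hν.le x t ht
      _ = _ := by ring
  calc ∫⁻ y in ball x (2 * t), g y ^ p ∂ν
      ≤ ∫⁻ y in ⋃ z ∈ s, ball (x + t • z) (t / 2), g y ^ p ∂ν :=
        lintegral_mono_set (hcov x t ht)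
    _ ≤ ∑ z ∈ s, ∫⁻ y in ball (x + t • z) (t / 2), g y ^ p ∂ν := by
        have := measure_biUnion_finset_le (μ := ν.withDensity fun y => g y ^ p) s
          (fun z => ball (x + t • z) (t / 2))
        rw [withDensity_apply _ (s.measurableSet_biUnion fun z _ => measurableSet_ball)] at this
        simpa only [withDensity_apply _ measurableSet_ball] using this
    _ ≤ ∑ _ ∈ s, D * (6 ^ n) ^ p * ν (ball x t) * L ^ p := Finset.sum_le_sum hone
    _ = _ := by
        rw [Finset.sum_const, nsmul_eq_mul]
        push_cast
        rw [ENNReal.coe_rpow_of_nonneg _ hp.le]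
        push_cast
        ring

section

variable {p q : ℝ} {W S : Rn n → ℝ≥0∞} {K : ℝ≥0}

/-- The near part. The bound is left as an average over B(x,3t), because the weak type estimate
needs its boundedness on L^1(v). -/
theorem IsDualPair.laverage_umax_indicator_le (h : IsDualPair p q W S K) :
    ∃ C : ℝ≥0, ∀ (t : ℝ), 0 < t → ∀ g : Rn n → ℝ≥0∞, Measurable g → ∀ x : Rn n,
      ⨍⁻ y in ball x t, umax volume ((ball x (2 * t)).indicator g) y ^ p
        ∂volume.withDensity W ≤
      C * (⨍⁻ u in ball x (3 * t), localMean (volume.withDensity W) p t g u ∂volume) ^ p := by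
  have hp := h.conj.pos
  obtain ⟨D, hD⟩ := h.controlsAverages.isDoubling hp
  obtain ⟨C₁, h₁⟩ := h.lintegral_umax_rpow_le
  obtain ⟨C₂, h₂⟩ := setLIntegral_ball_le_mul_laverage_localMean hD hp
  refine ⟨C₁ * C₂, fun t ht g hg x => ?_⟩
  set ν := volume.withDensity W
  set L := ⨍⁻ u in ball x (3 * t), localMean ν p t g u ∂volume
  rw [setLAverage_eq]
  refine ENNReal.div_le_of_le_mul ?_
  calc _ ≤ ∫⁻ y, umax volume ((ball x (2 * t)).indicator g) y ^ p ∂ν :=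
        setLIntegral_le_lintegral _ _
    _ ≤ C₁ * ∫⁻ y, (ball x (2 * t)).indicator g y ^ p ∂ν :=
        h₁ _ (hg.indicator measurableSet_ball)
    _ = C₁ * ∫⁻ y in ball x (2 * t), g y ^ p ∂ν := by
        rw [← lintegral_indicator measurableSet_ball]
        congr 1
        refine lintegral_congr fun y => ?_
        by_cases hy : y ∈ ball x (2 * t)
        · simp only [indicator_of_mem hy]
        · simp only [indicator_of_notMem hy, ENNReal.zero_rpow_of_pos hp]
    _ ≤ C₁ * (C₂ * ν (ball x t) * L ^ p) := mul_le_mul_right (h₂ t ht g x) _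
    _ = _ := by push_cast; ring

theorem IsDualPair.maximal_le_add (h : IsDualPair p q W S K) {t : ℝ} (ht : 0 < t)
    {g : Rn n → ℝ≥0∞} (hg : Measurable g) {x y : Rn n} (hxy : y ∈ ball x t) :
    maximal g y ≤ umax volume ((ball x (2 * t)).indicator g) y + ((K * 2 ^ n : ℝ≥0) : ℝ≥0∞) *
      umax volume (localMean (volume.withDensity W) p t g) x := by
  have hp := h.conj.pos
  have := Amalgam.maximal_le_add hg ht (fun u => h.controlsAverages.laverage_le hp hg u ht)
    (measurable_localMean _ p t g) hxy
  rw [ENNReal.coe_rpow_of_nonneg _ hp.le, ← ENNReal.rpow_mul, mul_one_div_cancel hp.ne',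
    ENNReal.rpow_one] at this
  push_cast
  exact this

/-- The local means of the maximal function are pointwise controlled by the maximal function
of the local means. -/
theorem IsDualPair.localMean_maximal_le (h : IsDualPair p q W S K) :
    ∃ C : ℝ≥0, ∀ (t : ℝ), 0 < t → ∀ g : Rn n → ℝ≥0∞, Measurable g → ∀ x : Rn n,
      localMean (volume.withDensity W) p t (maximal g) x ≤
        C * umax volume (localMean (volume.withDensity W) p t g) x := by
  have hp := h.conj.pos
  have hp1 : 0 ≤ 1 / p := one_div_nonneg.2 hp.le
  obtain ⟨D, hD⟩ := h.controlsAverages.isDoubling hp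
  obtain ⟨C₁, h₁⟩ := h.laverage_umax_indicator_le
  refine ⟨(2 ^ (p - 1) * (C₁ + (K * 2 ^ n) ^ p)) ^ (1 / p), fun t ht g hg x => ?_⟩
  set ν := volume.withDensity W
  set U := umax volume (localMean ν p t g) x
  set k : ℝ≥0 := K * 2 ^ n
  have hpt : ∀ y ∈ ball x t, maximal g y ^ p ≤ 2 ^ (p - 1) *
      (umax volume ((ball x (2 * t)).indicator g) y ^ p + (k * U) ^ p) := fun y hy =>
    (ENNReal.rpow_le_rpow (h.maximal_le_add ht hg hy) hp.le).trans
      (ENNReal.rpow_add_le_mul_rpow_add_rpow _ _ h.conj.lt.le)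
  have hν0 := hD.pos x t ht
  have hνt := hD.fin x t
  have key : ⨍⁻ y in ball x t, maximal g y ^ p ∂ν ≤
      (2 ^ (p - 1) * (C₁ + k ^ p) : ℝ≥0∞) * U ^ p := by
    calc ⨍⁻ y in ball x t, maximal g y ^ p ∂ν
        ≤ 2 ^ (p - 1) * (⨍⁻ y in ball x t, umax volume ((ball x (2 * t)).indicator g) y ^ p ∂ν
          + (k * U) ^ p) := by
          rw [setLAverage_eq, setLAverage_eq]
          refine ENNReal.div_le_of_le_mul ?_
          refine (setLIntegral_mono' measurableSet_ball hpt).trans_eq ?_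
          have hm : Measurable fun y => umax volume ((ball x (2 * t)).indicator g) y ^ p +
              (k * U) ^ p := ((measurable_umax _ _).pow_const _).add measurable_const
          rw [lintegral_const_mul _ hm, lintegral_add_right _ measurable_const,
            setLIntegral_const, mul_assoc, add_mul, ENNReal.div_mul_cancel hν0 hνt]
      _ ≤ 2 ^ (p - 1) * (C₁ * U ^ p + (k * U) ^ p) := by
          gcongr
          refine (h₁ t ht g hg x).trans ?_
          gcongr
          exact laverage_le_umax _ _ (mem_ball_self (by positivity))
      _ = _ := by rw [ENNReal.mul_rpow_of_nonneg _ _ hp.le]; ring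
  have := ENNReal.rpow_le_rpow key hp1
  rw [ENNReal.mul_rpow_of_nonneg _ _ hp1, ← ENNReal.rpow_mul, mul_one_div_cancel hp.ne',
    ENNReal.rpow_one] at this
  refine this.trans_eq ?_
  congr 1
  have hp' : 0 ≤ p - 1 := h.conj.sub_one_pos.le
  rw [ENNReal.coe_rpow_of_nonneg _ hp1]
  push_cast
  rw [ENNReal.coe_rpow_of_nonneg _ hp', ENNReal.coe_rpow_of_nonneg _ hp.le]
  push_cast
  rfl

/-- A pointwise bound for the local means of level sets of the maximal function. -/
theorem IsDualPair.mul_localMean_indicator_le (h : IsDualPair p q W S K) :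
    ∃ C₁ C₂ : ℝ≥0, C₁ ≠ 0 ∧ ∀ (t : ℝ), 0 < t → ∀ g : Rn n → ℝ≥0∞, Measurable g →
      ∀ (a : ℝ≥0∞) (x : Rn n), a ≠ ∞ →
      a * localMean (volume.withDensity W) p t ({y | a < maximal g y}.indicator fun _ => 1) x ≤
        {x | a < C₁ * umax volume (localMean (volume.withDensity W) p t g) x}.indicator
          (fun _ => a) x +
        C₂ * ⨍⁻ u in ball x (3 * t), localMean (volume.withDensity W) p t g u ∂volume := by
  have hp := h.conj.pos
  have hp1 : 0 ≤ 1 / p := one_div_nonneg.2 hp.le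
  obtain ⟨D, hD⟩ := h.controlsAverages.isDoubling hp
  obtain ⟨C, hC⟩ := h.laverage_umax_indicator_le
  -- The factor 2 halves the level between near and far parts; the summand 1 keeps the constant
  -- nonzero, so that levels can be divided by it.
  refine ⟨2 * (K * 2 ^ n + 1), 2 * C ^ (1 / p), by positivity, fun t ht g hg a x ha => ?_⟩
  set ν := volume.withDensity W
  set U := umax volume (localMean ν p t g) x
  set k : ℝ≥0 := K * 2 ^ n
  set L := ⨍⁻ u in ball x (3 * t), localMean ν p t g u ∂volume
  have hν0 := hD.pos x t ht
  have hνt := hD.fin x t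
  -- If the far part may be large, the local mean of an indicator is at most 1. Otherwise the far
  -- part is at most a/2, so the near part must exceed a/2 wherever the maximal function exceeds
  -- `a`.
  by_cases hU : a < (2 * (k + 1) : ℝ≥0) * U
  · rw [indicator_of_mem (by exact hU)]
    refine le_trans ?_ le_self_add
    refine mul_le_of_le_one_right zero_le ?_
    refine ENNReal.rpow_le_one ?_ hp1
    rw [setLAverage_eq]
    refine ENNReal.div_le_of_le_mul ?_
    rw [one_mul, ← setLIntegral_one]
    refine lintegral_mono fun y => ENNReal.rpow_le_one ?_ hp.le
    exact indicator_le_self' (fun _ _ => zero_le) y |>.trans le_rfl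
  · rw [indicator_of_notMem (by exact hU), zero_add]
    have hkU : k * U ≤ a / 2 := by
      rw [ENNReal.le_div_iff_mul_le (by simp) (by simp)]
      refine le_trans ?_ (not_lt.1 hU)
      push_cast
      calc (k : ℝ≥0∞) * U * 2 = 2 * k * U := by ring
        _ ≤ _ := by gcongr; exact le_self_add
    have hpt : ∀ y ∈ ball x t,
        (a * {y | a < maximal g y}.indicator (fun _ => (1 : ℝ≥0∞)) y) ^ p ≤
        (2 * umax volume ((ball x (2 * t)).indicator g) y) ^ p := by
      intro y hy
      refine ENNReal.rpow_le_rpow ?_ hp.le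
      by_cases hay : a < maximal g y
      · rw [indicator_of_mem (by exact hay), mul_one]
        by_contra hcon
        have h1 : umax volume ((ball x (2 * t)).indicator g) y ≤ a / 2 := by
          rw [ENNReal.le_div_iff_mul_le (by simp) (by simp), mul_comm]
          exact (not_le.1 hcon).le
        have h2 := (h.maximal_le_add ht hg hy).trans (add_le_add h1 hkU)
        rw [ENNReal.add_halves] at h2
        exact absurd hay (not_lt.2 h2)
      · rw [indicator_of_notMem (by exact hay), mul_zero]
        exact zero_le
    have hset : MeasurableSet {y | a < maximal g y} :=
      measurableSet_lt measurable_const (measurable_maximal g)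
    have key : a ^ p * ⨍⁻ y in ball x t, {y | a < maximal g y}.indicator
        (fun _ => (1 : ℝ≥0∞)) y ^ p ∂ν ≤ (2 : ℝ≥0∞) ^ p * C * L ^ p := by
      calc _ ≤ 2 ^ p * ⨍⁻ y in ball x t,
            umax volume ((ball x (2 * t)).indicator g) y ^ p ∂ν := by
            rw [setLAverage_eq, setLAverage_eq, ← mul_div_assoc, ← mul_div_assoc]
            refine ENNReal.div_le_div_right ?_ _
            rw [← lintegral_const_mul _ ((measurable_const.indicator hset).pow_const _),
              ← lintegral_const_mul _ ((measurable_umax _ _).pow_const _)]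
            simp_rw [← ENNReal.mul_rpow_of_nonneg _ _ hp.le]
            exact setLIntegral_mono' measurableSet_ball hpt
        _ ≤ 2 ^ p * (C * L ^ p) := mul_le_mul_right (hC t ht g hg x) _
        _ = _ := by ring
    have := ENNReal.rpow_le_rpow key hp1
    rw [ENNReal.mul_rpow_of_nonneg _ _ hp1, ENNReal.mul_rpow_of_nonneg _ _ hp1,
      ENNReal.mul_rpow_of_nonneg _ _ hp1,
      ← ENNReal.rpow_mul, ← ENNReal.rpow_mul, ← ENNReal.rpow_mul, mul_one_div_cancel hp.ne',
      ENNReal.rpow_one, ENNReal.rpow_one, ENNReal.rpow_one,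
      ← ENNReal.coe_rpow_of_nonneg _ hp1] at this
    refine this.trans_eq ?_
    push_cast
    rfl

end

theorem mul_measure_lt_le_of_le_mul {X : Type*} [MeasurableSpace X] {μ : Measure X}
    {f g : X → ℝ≥0∞} {c : ℝ≥0} {b : ℝ≥0∞} (hc : c ≠ 0) (hfg : ∀ x, f x ≤ c * g x)
    (hg : ∀ a, a * μ {x | a < g x} ≤ b) (a : ℝ≥0∞) : a * μ {x | a < f x} ≤ c * b := by
  have hc' : (c : ℝ≥0∞) ≠ 0 := by simpa using hc
  have hsub : {x | a < f x} ⊆ {x | a / c < g x} := by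
    intro x hx
    rw [mem_ofPred_eq, ENNReal.div_lt_iff (Or.inl hc') (Or.inl ENNReal.coe_ne_top), mul_comm]
    exact lt_of_lt_of_le hx (hfg x)
  calc a * μ {x | a < f x} ≤ a * μ {x | a / c < g x} := by gcongr
    _ = c * (a / c * μ {x | a / c < g x}) := by
        rw [← mul_assoc, ENNReal.mul_div_cancel hc' ENNReal.coe_ne_top]
    _ ≤ c * b := mul_le_mul_right (hg _) _

/-! ### Estimates for A_1 weights. -/

/-- A regular weight satisfying the `A_1` condition. -/
structure IsRegularAOne (V : Rn n → ℝ≥0∞) (K : ℝ≥0) : Prop where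
  weight : IsRegularWeight V
  le : ∀ᵐ x, maximal V x ≤ K * V x

section

variable {V : Rn n → ℝ≥0∞} {K : ℝ≥0}

theorem IsRegularAOne.controlsAverages (h : IsRegularAOne V K) :
    ControlsAverages 1 (volume.withDensity V) (2 ^ n * K) := by
  refine ⟨h.weight.pos, h.weight.fin, fun g hg c r hr => ?_⟩
  simp_rw [ENNReal.rpow_one]
  set B := ball c r
  have hB0 : volume B ≠ 0 := volume_ball_ne_zero c hr
  have hBt : volume B ≠ ∞ := volume_ball_ne_top c r
  have hpt : ∀ᵐ y, y ∈ B → g y * volume.withDensity V B ≤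
      (2 ^ n * K * volume B) * (V y * g y) := by
    filter_upwards [h.le] with y hy hyB
    -- The maximal function in the A_1 condition is centred, so `B` is enlarged to a ball about y of
    -- twice the radius; hence the factor 2^n.
    have h1 : volume.withDensity V B ≤ volume (ball y (2 * r)) * (K * V y) := by
      refine le_trans ?_ (mul_le_mul_right ((laverage_le_maximal V y
        (by positivity : 0 < 2 * r)).trans hy) _)
      rw [volume_mul_laverage V y (by positivity), withDensity_apply _ measurableSet_ball]
      refine lintegral_mono_set (ball_subset_ball' ?_)
      have := mem_ball'.1 hyB
      linarith
    rw [volume_ball_mul y c two_pos, ENNReal.ofReal_pow zero_le_two, ENNReal.ofReal_ofNat] at h1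
    calc _ ≤ g y * (2 ^ n * volume B * (K * V y)) := mul_le_mul_right h1 _
      _ = _ := by ring
  rw [setLAverage_eq, ENNReal.div_eq_inv_mul, mul_assoc, ← lintegral_mul_const _ hg,
    h.weight.setLIntegral hg measurableSet_ball]
  calc (volume B)⁻¹ * ∫⁻ y in B, g y * volume.withDensity V B
      ≤ (volume B)⁻¹ * ∫⁻ y in B, (2 ^ n * K * volume B) * (V y * g y) :=
        mul_le_mul_right (lintegral_mono_ae ((ae_restrict_iff' measurableSet_ball).2 hpt)) _
    _ = ((volume B)⁻¹ * volume B) * (2 ^ n * K * ∫⁻ y in B, V y * g y) := by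
        have hm : Measurable fun y => V y * g y := h.weight.measurable.mul hg
        rw [lintegral_const_mul _ hm]; ring
    _ = _ := by rw [ENNReal.inv_mul_cancel hB0 hBt, one_mul]; push_cast; rfl

/-- Under A_1, Lebesgue averages are dominated by `V`-averages, so the weak (1,1) bound for the
doubling measure `V` transfers. -/
theorem IsRegularAOne.mul_measure_lt_umax_le (h : IsRegularAOne V K) :
    ∃ C : ℝ≥0, ∀ F : Rn n → ℝ≥0∞, Measurable F → ∀ a,
      a * volume.withDensity V {x | a < umax volume F x} ≤
        C * ∫⁻ x, F x ∂volume.withDensity V := by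
  obtain ⟨D, hD⟩ := h.controlsAverages.isDoubling one_pos
  refine ⟨(2 ^ n * K + 1) * D, fun F hF a => ?_⟩
  have := mul_measure_lt_le_of_le_mul (μ := volume.withDensity V) (c := 2 ^ n * K + 1)
    (by positivity) (f := umax volume F) (g := umax (volume.withDensity V) F) (fun x => ?_)
    (hD.mul_measure_lt_umax_le F) a
  · push_cast at this ⊢
    rwa [mul_assoc]
  · refine umax_le fun c r hx => ?_
    have h1 := h.controlsAverages.laverage_le one_pos hF c (pos_of_mem_ball hx)
    simp only [ENNReal.rpow_one, one_div_one] at h1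
    refine h1.trans (mul_le_mul' ?_ (laverage_le_umax _ _ hx))
    push_cast
    exact le_self_add

/-- At a fixed radius Tonelli moves the averaging onto `V`, and MV ≤ KV gives a strong L^1 bound
uniform in the radius. -/
theorem IsRegularAOne.lintegral_laverage_ball_le (h : IsRegularAOne V K) {F : Rn n → ℝ≥0∞}
    (hF : Measurable F) {r : ℝ} (hr : 0 < r) :
    ∫⁻ x, ⨍⁻ u in ball x r, F u ∂volume ∂volume.withDensity V ≤
      K * ∫⁻ x, F x ∂volume.withDensity V := by
  set b := volume (ball (0 : Rn n) r)
  have hb : ∀ u : Rn n, volume (ball u r) = b := fun u => Measure.addHaar_ball_center volume u r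
  rw [h.weight.lintegral (measurable_laverage_ball _ _ _), h.weight.lintegral hF]
  simp_rw [setLAverage_eq, hb, ENNReal.div_eq_inv_mul, mul_left_comm _ b⁻¹]
  have hm₁ : Measurable fun x => V x * ∫⁻ u in ball x r, F u :=
    h.weight.measurable.mul (measurable_setLIntegral_ball _ _ _)
  have hm₂ : Measurable fun x => F x * ∫⁻ u in ball x r, V u :=
    hF.mul (measurable_setLIntegral_ball _ _ _)
  have hm₃ : Measurable fun x => V x * F x := h.weight.measurable.mul hF
  rw [lintegral_const_mul _ hm₁, lintegral_mul_setLIntegral_ball_comm h.weight.measurable hF,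
    ← lintegral_const_mul _ hm₂, ← lintegral_const_mul _ hm₃]
  refine lintegral_mono_ae ?_
  filter_upwards [h.le] with y hy
  have h1 := (laverage_le_maximal V y hr).trans hy
  rw [setLAverage_eq, hb, ENNReal.div_eq_inv_mul] at h1
  calc _ = F y * (b⁻¹ * ∫⁻ u in ball y r, V u) := by ring
    _ ≤ F y * (K * V y) := mul_le_mul_right h1 _
    _ = _ := by ring

end

/-! ### Regular representatives of the given weights. -/

theorem IsWeight.exists_isRegularWeight {w : Rn n → ℝ} (hw : IsWeight w) :
    ∃ W : Rn n → ℝ≥0∞, IsRegularWeight W ∧ (fun x => ENNReal.ofReal (w x)) =ᵐ[volume] W ∧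
      wMeasure w = volume.withDensity W := by
  have hm : AEMeasurable (fun x => ENNReal.ofReal (w x)) (volume : Measure (Rn n)) :=
    hw.1.aestronglyMeasurable.aemeasurable.ennreal_ofReal
  classical
  -- Altering a null set removes the values 0 and ∞, so powers and quotients of weights cancel at
  -- every point.
  let W : Rn n → ℝ≥0∞ := fun x => if hm.mk _ x = 0 ∨ hm.mk _ x = ∞ then 1 else hm.mk _ x
  have hW : (fun x => ENNReal.ofReal (w x)) =ᵐ[volume] W := by
    filter_upwards [hm.ae_eq_mk, hw.2] with x hx hpos
    have : ¬(hm.mk _ x = 0 ∨ hm.mk _ x = ∞) := by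
      rw [← hx]; simp [hpos]
    simp only [W, if_neg this]
    exact hx
  have hd : wMeasure w = volume.withDensity W := withDensity_congr_ae hW
  refine ⟨W, ⟨?_, ?_, ?_, ?_⟩, hW, hd⟩
  · have h0 := hm.measurable_mk (measurableSet_singleton 0)
    have ht := hm.measurable_mk (measurableSet_singleton ∞)
    exact Measurable.ite (h0.union ht) measurable_const hm.measurable_mk
  · intro x
    by_cases h : hm.mk _ x = 0 ∨ hm.mk _ x = ∞
    · simp only [W, if_pos h]; exact one_ne_zero
    · simp only [W, if_neg h]; exact fun h' => h (Or.inl h')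
  · intro x
    by_cases h : hm.mk _ x = 0 ∨ hm.mk _ x = ∞
    · simp only [W, if_pos h]; exact ENNReal.one_ne_top
    · simp only [W, if_neg h]; exact fun h' => h (Or.inr h')
  · intro c r
    rw [← hd, wMeasure, withDensity_apply _ measurableSet_ball]
    have hint : IntegrableOn w (ball c r) volume :=
      (hw.1.integrableOn_isCompact (isCompact_closedBall c r)).mono_set ball_subset_closedBall
    exact hint.lintegral_lt_top.ne

theorem IsAp.exists_isDualPair {p : ℝ} (hp : 1 < p) {w : Rn n → ℝ} (hw : IsAp p w) :
    ∃ (q : ℝ) (W S : Rn n → ℝ≥0∞) (K : ℝ≥0), IsDualPair p q W S K ∧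
      wMeasure w = volume.withDensity W := by
  obtain ⟨W, hW, hae, hd⟩ := hw.1.exists_isRegularWeight
  have hp0 : 0 < p := by linarith
  have hp1 : 0 < p - 1 := by linarith
  have hconj := Real.HolderConjugate.conjExponent hp
  set q := Real.conjExponent p
  have hq : 0 < q := hconj.symm.pos
  have hqe : 1 / q = (p - 1) / p := by
    rw [← hconj.div_conj_eq_sub_one]; field_simp
  set S : Rn n → ℝ≥0∞ := fun x => W x ^ (1 / (1 - p)) with hS
  obtain ⟨K₀, hK₀⟩ : ∃ K₀ : ℝ≥0, (K₀ : ℝ≥0∞) = _ := WithTop.ne_top_iff_exists.1 hw.2.ne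
  have hSm : Measurable S := hW.measurable.pow_const _
  have hK : ∀ (c : Rn n) (r : ℝ), 0 < r → (volume.withDensity W (ball c r) / volume (ball c r)) *
      (volume.withDensity S (ball c r) / volume (ball c r)) ^ (p - 1) ≤ K₀ := by
    intro c r hr
    rw [hK₀]
    refine le_trans (le_of_eq ?_) (le_iSup_of_le c (le_iSup_of_le r (le_iSup_of_le hr le_rfl)))
    rw [setLAverage_eq, setLAverage_eq, withDensity_apply _ measurableSet_ball,
      withDensity_apply _ measurableSet_ball]
    have hae' := ae_restrict_of_ae (s := ball c r) hae
    have haeS : (fun x => ENNReal.ofReal (w x) ^ (1 / (1 - p))) =ᵐ[volume.restrict (ball c r)] S :=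
      hae'.mono fun x hx => congrArg (· ^ (1 / (1 - p))) hx
    rw [lintegral_congr_ae hae', lintegral_congr_ae haeS]
  have hSfin : ∀ (c : Rn n) (r : ℝ), volume.withDensity S (ball c r) ≠ ∞ := by
    intro c r
    rcases le_or_gt r 0 with hr | hr
    · simp [ball_eq_empty.2 hr]
    -- The average of `W` is positive, so infinite mass of the dual weight would contradict the A_p
    -- bound.
    · intro htop
      have := hK c r hr
      rw [htop, ENNReal.top_div_of_ne_top (volume_ball_ne_top c r), ENNReal.top_rpow_of_pos hp1,
        ENNReal.mul_top] at this
      · exact absurd this (by simp)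
      · exact (ENNReal.div_pos (hW.pos c r hr) (volume_ball_ne_top c r)).ne'
  refine ⟨q, W, S, K₀ ^ (1 / p), ⟨hconj, hW, ⟨hSm, fun x => ?_, fun x => ?_, hSfin⟩,
    fun x => ?_, fun c r hr => ?_⟩, hd⟩
  · simp [hS, ENNReal.rpow_eq_zero_iff, hW.ne_zero x, hW.ne_top x]
  · simp [hS, ENNReal.rpow_eq_top_iff, hW.ne_zero x, hW.ne_top x]
  · rw [hS, ← ENNReal.rpow_mul, ← ENNReal.rpow_add _ _ (hW.ne_zero x) (hW.ne_top x), hqe]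
    have : 1 / p + 1 / (1 - p) * ((p - 1) / p) = 0 := by
      have : 1 - p ≠ 0 := by linarith
      field_simp; ring
    rw [this, ENNReal.rpow_zero]
  · have hB0 := volume_ball_ne_zero c hr
    have hBt := volume_ball_ne_top c r
    have h1 := ENNReal.rpow_le_rpow (hK c r hr) (one_div_nonneg.2 hp0.le)
    have e : (p - 1) * (1 / p) = 1 / q := by rw [hqe]; ring
    rw [ENNReal.mul_rpow_of_nonneg _ _ (one_div_nonneg.2 hp0.le), ← ENNReal.rpow_mul, e,
      ENNReal.div_rpow_of_nonneg _ _ (one_div_nonneg.2 hp0.le),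
      ENNReal.div_rpow_of_nonneg _ _ (one_div_nonneg.2 hq.le),
      div_eq_mul_inv (volume.withDensity W (ball c r) ^ _),
      div_eq_mul_inv (volume.withDensity S (ball c r) ^ _),
      ← ENNReal.rpow_neg, ← ENNReal.rpow_neg] at h1
    have h2 : volume (ball c r) ^ (-(1 / p)) * volume (ball c r) ^ (-(1 / q)) =
        (volume (ball c r))⁻¹ := by
      rw [← ENNReal.rpow_add _ _ hB0 hBt, ← ENNReal.rpow_neg_one]
      congr 1
      have := hconj.inv_add_inv_eq_one
      rw [one_div, one_div]; linarith
    rw [mul_mul_mul_comm, h2, ← div_eq_mul_inv, ENNReal.div_le_iff_le_mul (Or.inl hB0)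
      (Or.inl hBt)] at h1
    rwa [ENNReal.coe_rpow_of_nonneg _ (one_div_nonneg.2 hp0.le)]

theorem maximal_congr {F G : Type*} [ENorm F] [ENorm G] {f : Rn n → F} {g : Rn n → G}
    (h : (fun x => ‖f x‖ₑ) =ᵐ[volume] fun x => ‖g x‖ₑ) : maximal f = maximal g := by
  ext x
  refine iSup_congr fun r => iSup_congr fun _ => ?_
  rw [setLAverage_eq, setLAverage_eq, lintegral_congr_ae (ae_restrict_of_ae h)]

theorem IsAOne.exists_isRegularAOne {v : Rn n → ℝ} (hv : IsAOne v) :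
    ∃ (V : Rn n → ℝ≥0∞) (K : ℝ≥0), IsRegularAOne V K ∧ wMeasure v = volume.withDensity V := by
  obtain ⟨V, hV, hae, hd⟩ := hv.1.exists_isRegularWeight
  obtain ⟨C, hC⟩ := hv.2
  refine ⟨V, C, ⟨hV, ?_⟩, hd⟩
  have hmax : maximal v = maximal V := by
    refine maximal_congr ?_
    filter_upwards [hae, hv.1.2] with x hx hpos
    rw [enorm_eq_self, ← hx, Real.enorm_of_nonneg hpos.le]
  filter_upwards [hC, hae] with x hx hx'
  rwa [hmax, hx'] at hx

/-- For q < ∞ this is Muckenhoupt's theorem. For q = ∞ averages never exceed the Lebesgue essential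
supremum, which is at most the one for v dx since v > 0 almost everywhere. -/
theorem IsMuckenhoupt.eLpNorm_umax_le {q : ℝ≥0∞} (hq : 1 < q) {v : Rn n → ℝ}
    (hv : IsMuckenhoupt q v) : ∃ C : ℝ≥0, ∀ F : Rn n → ℝ≥0∞, Measurable F →
      eLpNorm (umax volume F) q (wMeasure v) ≤ C * eLpNorm F q (wMeasure v) := by
  rcases hv with ⟨rfl, _⟩ | ⟨_, hqt, hv⟩ | ⟨rfl, hv⟩
  · exact absurd hq (lt_irrefl 1)
  · have hq1 : 1 < q.toReal := by
      rw [← ENNReal.toReal_one]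
      exact (ENNReal.toReal_lt_toReal ENNReal.one_ne_top hqt.ne).2 hq
    have hq0 : 0 < q.toReal := by linarith
    obtain ⟨q', V, S, K, h, hd⟩ := hv.exists_isDualPair hq1
    obtain ⟨C, hC⟩ := h.lintegral_umax_rpow_le
    refine ⟨C ^ (1 / q.toReal), fun F hF => ?_⟩
    have hi := one_div_nonneg.2 hq0.le
    rw [hd, eLpNorm_eq_lintegral_rpow_enorm_toReal (by rintro rfl; simp at hq) hqt.ne,
      eLpNorm_eq_lintegral_rpow_enorm_toReal (by rintro rfl; simp at hq) hqt.ne,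
      ENNReal.coe_rpow_of_nonneg _ hi, ← ENNReal.mul_rpow_of_nonneg _ _ hi]
    simp only [enorm_eq_self]
    exact ENNReal.rpow_le_rpow (hC F hF) hi
  · have hw : IsWeight v := by
      rcases hv with h | ⟨_, _, h⟩
      exacts [h.1, h.1]
    obtain ⟨V, hV, _, hd⟩ := hw.exists_isRegularWeight
    refine ⟨1, fun F hF => ?_⟩
    rw [ENNReal.coe_one, one_mul, eLpNorm_exponent_top, eLpNorm_exponent_top, eLpNormEssSup,
      eLpNormEssSup]
    simp only [enorm_eq_self]
    refine essSup_le_of_ae_le _ (Filter.Eventually.of_forall fun x => ?_)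
    refine (umax_le_essSup F x).trans ?_
    rw [hd]
    exact essSup_mono_measure hV.absolutelyContinuous

theorem amalgamNorm_eq {F : Type*} [ENorm F] {t p : ℝ} {q : ℝ≥0∞} {w v : Rn n → ℝ}
    {W : Rn n → ℝ≥0∞} (hd : wMeasure w = volume.withDensity W) {f : Rn n → F} {g : Rn n → ℝ≥0∞}
    (hfg : (fun x => ‖f x‖ₑ) =ᵐ[volume] g) :
    amalgamNorm t p q w v f =
      eLpNorm (localMean (volume.withDensity W) p t g) q (wMeasure v) := by
  unfold amalgamNorm localMean
  rw [hd]
  congr 1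
  ext u
  have h : (fun x => ‖f x‖ₑ) =ᵐ[volume.withDensity W] g :=
    (withDensity_absolutelyContinuous volume W) hfg
  rw [setLAverage_eq, setLAverage_eq]
  congr 2
  exact lintegral_congr_ae ((ae_restrict_of_ae h).mono fun x hx => congrArg (· ^ p) hx)

end Amalgam

/-! ### The strong and weak amalgam bounds. -/

open Amalgam in
theorem theorem1p1 (n : ℕ) (p : ℝ) (hp : 1 < p) (w : Amalgam.Rn n → ℝ)
    (hw : Amalgam.IsAp p w) :
    (∀ (q : ℝ≥0∞) (v : Amalgam.Rn n → ℝ), 1 < q → Amalgam.IsMuckenhoupt q v →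
      ∃ C : ℝ≥0, 0 < C ∧ ∀ (t : ℝ), 0 < t → ∀ f : Amalgam.Rn n → ℂ,
        Amalgam.MemAmalgam t p q w v f →
          Amalgam.MemAmalgam t p q w v (Amalgam.maximal f) ∧
          Amalgam.amalgamNorm t p q w v (Amalgam.maximal f)
            ≤ C * Amalgam.amalgamNorm t p q w v f) ∧
    (∀ v : Amalgam.Rn n → ℝ, Amalgam.IsAOne v →
      ∃ C : ℝ≥0, 0 < C ∧ ∀ (t : ℝ), 0 < t → ∀ f : Amalgam.Rn n → ℂ,
        Amalgam.MemAmalgam t p 1 w v f →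
          Amalgam.MemWeakAmalgam t p 1 w v (Amalgam.maximal f) ∧
          Amalgam.weakAmalgamNorm t p 1 w v (Amalgam.maximal f)
            ≤ C * Amalgam.amalgamNorm t p 1 w v f) := by
  obtain ⟨p', W, S, K, h, hd⟩ := hw.exists_isDualPair hp
  have hp0 : 0 < p := by linarith
  refine ⟨fun q v hq hv => ?_, fun v hv => ?_⟩
  · obtain ⟨C₁, h₁⟩ := h.localMean_maximal_le
    obtain ⟨C₂, h₂⟩ := hv.eLpNorm_umax_le hq
    refine ⟨C₁ * C₂ + 1, by positivity, fun t ht f hf => ?_⟩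
    -- Both sides depend only on |f| up to null sets, so a Borel representative `g` may replace it.
    obtain ⟨g, hg, hfg⟩ := hf.1.enorm
    have key : amalgamNorm t p q w v (maximal f) ≤
        ((C₁ * C₂ + 1 : ℝ≥0) : ℝ≥0∞) * amalgamNorm t p q w v f := by
      rw [maximal_congr (g := g) (by simpa using hfg), amalgamNorm_eq hd hfg,
        amalgamNorm_eq hd (g := maximal g) (by simp)]
      calc _ ≤ C₁ * eLpNorm (umax volume (localMean (volume.withDensity W) p t g)) q
            (wMeasure v) := eLpNorm_le_mul_eLpNorm_of_ae_le_mul'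
              (Filter.Eventually.of_forall (h₁ t ht g hg)) q
        _ ≤ C₁ * (C₂ * eLpNorm (localMean (volume.withDensity W) p t g) q (wMeasure v)) :=
            mul_le_mul_right (h₂ _ (measurable_localMean _ p t g)) _
        _ ≤ _ := by
            rw [← mul_assoc]
            push_cast
            exact mul_le_mul_left le_self_add _
    exact ⟨⟨(measurable_maximal f).aestronglyMeasurable,
      key.trans_lt (ENNReal.mul_lt_top ENNReal.coe_lt_top hf.2)⟩, key⟩
  · obtain ⟨V, K', hV, hdv⟩ := hv.exists_isRegularAOne
    obtain ⟨C₁, C₂, hC₁, h₁⟩ := h.mul_localMean_indicator_le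
    obtain ⟨C₃, h₃⟩ := hV.mul_measure_lt_umax_le
    refine ⟨C₁ * C₃ + C₂ * K' + 1, by positivity, fun t ht f hf => ?_⟩
    obtain ⟨g, hg, hfg⟩ := hf.1.enorm
    have key : weakAmalgamNorm t p 1 w v (maximal f) ≤
        ((C₁ * C₃ + C₂ * K' + 1 : ℝ≥0) : ℝ≥0∞) * amalgamNorm t p 1 w v f := by
      rw [maximal_congr (g := g) (by simpa using hfg), amalgamNorm_eq hd hfg]
      set F := localMean (volume.withDensity W) p t g
      have hF : Measurable F := measurable_localMean _ p t g
      refine iSup₂_le fun a ha => ?_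
      simp only [enorm_eq_self]
      rw [amalgamNorm_eq hd (g := {y | (a : ℝ≥0∞) < maximal g y}.indicator fun _ => 1)
        (by simp), eLpNorm_one_eq_lintegral_enorm, eLpNorm_one_eq_lintegral_enorm, hdv]
      simp only [enorm_eq_self]
      have hset : MeasurableSet {x | (a : ℝ≥0∞) < C₁ * umax volume F x} :=
        measurableSet_lt measurable_const ((measurable_umax _ _).const_mul _)
      rw [← lintegral_const_mul _ (measurable_localMean _ p t _)]
      calc _ ≤ ∫⁻ x, {x | (a : ℝ≥0∞) < C₁ * umax volume F x}.indicator (fun _ => (a : ℝ≥0∞)) x +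
            C₂ * (⨍⁻ u in ball x (3 * t), F u ∂volume) ∂volume.withDensity V :=
            lintegral_mono fun x => h₁ t ht g hg a x ENNReal.coe_ne_top
        _ = a * volume.withDensity V {x | (a : ℝ≥0∞) < C₁ * umax volume F x} + C₂ *
            ∫⁻ x, ⨍⁻ u in ball x (3 * t), F u ∂volume ∂volume.withDensity V := by
            rw [lintegral_add_left (measurable_const.indicator hset),
              lintegral_const_mul _ (measurable_laverage_ball _ _ _), lintegral_indicator hset,
              setLIntegral_const]
        -- The far part uses the weak (1,1) bound, the near part the strong L^1 bound for averages
        -- at radius 3t.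
        _ ≤ C₁ * (C₃ * ∫⁻ x, F x ∂volume.withDensity V) +
            C₂ * (K' * ∫⁻ x, F x ∂volume.withDensity V) :=
            add_le_add (mul_measure_lt_le_of_le_mul hC₁ (fun x => le_rfl) (h₃ F hF) a)
              (mul_le_mul_right (hV.lintegral_laverage_ball_le hF (by positivity)) _)
        _ = (C₁ * C₃ + C₂ * K') * ∫⁻ x, F x ∂volume.withDensity V := by ring
        _ ≤ _ := by
            push_cast
            exact mul_le_mul_left le_self_add _
    exact ⟨⟨(measurable_maximal f).aestronglyMeasurable,
      key.trans_lt (ENNReal.mul_lt_top ENNReal.coe_lt_top hf.2)⟩, key⟩
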